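/- **Definitions.** A triple system $\mathrm{TS}(v;b)$ is a pair $(V,\mathcal F)$ where $V$ is a set of $v$ points and $\mathcal F$ is a family of $b$ three-element subsets of $V$ (blocks; repeated blocks are allowed). For $T\subseteq V$ let $\lambda_T$ be the number of blocks of $\mathcal F$ (with multiplicity) containing $T$. The system is 3-balanced if $|\lambda_S-\lambda_T|\le 1$ for all 3-subsets $S,T$ of $V$. The pair $(v,b)$ satisfies (C2) if $v$ is even and $$\frac{\lambda v(v-1)}{6}-\frac v6<b<\frac{\lambda v(v-1)}{6}+\frac v6$$ for some odd integer $\lambda$; in that case write $3b=\lambda\binom v2+\varepsilon$ with $\varepsilon$ an integer, $-\frac v2<\varepsilon<\frac v2$. For a nonzero integer $i$ let $D_i$ be the set of pairs $\{x,y\}\subseteq V$, $x\ne y$, with $\lambda_{\{x,y\}}=\lambda+i$. A $\mathrm{TS}(v;b)$ with $(v,b)$ satisfying (C2) is nearly 2-balanced if $D_i=\emptyset$ for all $i\notin\{0,1,-1\}$ and the graph on $V$ with edge set $D_1\cup D_{-1}$ has the following form: * if $\varepsilon\equiv\frac v2\pmod 2$: it is a perfect matching of $V$ with $\frac{v+2\varepsilon}{4}$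 edges in $D_1$ and $\frac{v-2\varepsilon}{4}$ edges in $D_{-1}$; * if $\varepsilon\not\equiv\frac v2\pmod 2$: it is the vertex-disjoint union, covering $V$, of a star $K_{1,3}$ and a matching, where either the star has two edges in $D_1$ and one in $D_{-1}$ and the matching has $\frac{v-6+2\varepsilon}{4}$ edges in $D_1$ and $\frac{v-2-2\varepsilon}{4}$ in $D_{-1}$, or the star has one edge in $D_1$ and two in $D_{-1}$ and the matching has $\frac{v-2+2\varepsilon}{4}$ edges in $D_1$ and $\frac{v-6-2\varepsilon}{4}$ in $D_{-1}$. For $(v,b)$ satisfying (C2), a nearly well-balanced triple system $\mathrm{NWBTS}(v;b)$ is a $\mathrm{TS}(v;b)$ that is nearly 2-balanced and 3-balanced. **Theorem.** Let $v\equiv 0\pmod 6$ and let $(v,b)$ satisfy (C2). Then there exists an $\mathrm{NWBTS}(v;b)$. -/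

import Mathlib

namespace TripleSystems

/-- The number `λ_T` of blocks of the family `F` (a multiset, so repeated blocks are allowed and
are counted with multiplicity) that contain the set of points `T`. -/
def blockCount {V : Type*} [DecidableEq V] (F : Multiset (Finset V)) (T : Finset V) : ℕ :=
  F.countP (fun B => T ⊆ B)

/-- `(V, F)` is a triple system with `b` blocks: `F` consists of `b` blocks of size three. -/
def IsTripleSystem {V : Type*} (F : Multiset (Finset V)) (b : ℕ) : Prop :=
  F.card = b ∧ ∀ B ∈ F, B.card = 3

/-- `F` is `j`-balanced: the numbers `λ_T`, for `T` a `j`-subset, differ by at most one. -/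
def IsBalanced {V : Type*} [DecidableEq V] (F : Multiset (Finset V)) (j : ℕ) : Prop :=
  ∀ S T : Finset V, S.card = j → T.card = j →
    |(blockCount F S : ℤ) - (blockCount F T : ℤ)| ≤ 1

/-- Condition (C2): `v` is even and
`λ v (v - 1) / 6 - v / 6 < b < λ v (v - 1) / 6 + v / 6` for an odd integer `λ`. -/
def SatisfiesC2 (v b : ℕ) : Prop :=
  Even v ∧ ∃ lam : ℤ, Odd lam ∧
    (lam : ℚ) * v * ((v : ℚ) - 1) / 6 - (v : ℚ) / 6 < b ∧
    (b : ℚ) < (lam : ℚ) * v * ((v : ℚ) - 1) / 6 + (v : ℚ) / 6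

/-- `(v, b)` associates with `(λ, ε)`: `3 b = λ (v choose 2) + ε` with `-v / 2 < ε < v / 2`. -/
def IsAssociated (v b : ℕ) (lam eps : ℤ) : Prop :=
  3 * (b : ℤ) = lam * (v.choose 2 : ℤ) + eps ∧
    -(v : ℚ) / 2 < (eps : ℚ) ∧ (eps : ℚ) < (v : ℚ) / 2

/-- The defect graph at level `i` (relative to `lam`): the pairs `{x, y}` that lie in exactly
`lam + i` blocks. -/
def defectGraph {V : Type*} [DecidableEq V] (F : Multiset (Finset V)) (lam i : ℤ) :
    SimpleGraph V where
  Adj x y := x ≠ y ∧ (blockCount F {x, y} : ℤ) = lam + i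
  symm := ⟨fun x y h => ⟨h.1.symm, by rw [Finset.pair_comm]; exact h.2⟩⟩
  loopless := ⟨fun _ h => h.1 rfl⟩

/-- A graph each of whose edges is drawn either as a solid line or as a dotted line. -/
structure TwoColoredGraph (W : Type*) where
  /-- the solid edges -/
  solid : SimpleGraph W
  /-- the dotted edges -/
  dotted : SimpleGraph W

/-- `p` solid edges and `q` dotted edges, pairwise vertex-disjoint, with no further vertices. -/
def matchingGraph (p q : ℕ) : TwoColoredGraph ((Fin p ⊕ Fin q) × Bool) where
  solid :=
    { Adj := fun x y => x.1 = y.1 ∧ x.1.isLeft ∧ x.2 ≠ y.2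
      symm := ⟨fun _ _ h => ⟨h.1.symm, h.1 ▸ h.2.1, h.2.2.symm⟩⟩
      loopless := ⟨fun _ h => h.2.2 rfl⟩ }
  dotted :=
    { Adj := fun x y => x.1 = y.1 ∧ x.1.isRight ∧ x.2 ≠ y.2
      symm := ⟨fun _ _ h => ⟨h.1.symm, h.1 ▸ h.2.1, h.2.2.symm⟩⟩
      loopless := ⟨fun _ h => h.2.2 rfl⟩ }

/-- The star on four vertices with centre `0`, two solid edges and one dotted edge. -/
def starTwoSolid : TwoColoredGraph (Fin 4) where
  solid := SimpleGraph.fromEdgeSet {s(0, 1), s(0, 2)}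
  dotted := SimpleGraph.fromEdgeSet {s(0, 3)}

/-- The star on four vertices with centre `0`, one solid edge and two dotted edges. -/
def starOneSolid : TwoColoredGraph (Fin 4) where
  solid := SimpleGraph.fromEdgeSet {s(0, 1)}
  dotted := SimpleGraph.fromEdgeSet {s(0, 2), s(0, 3)}

/-- Disjoint union of two graphs with solid and dotted edges. -/
def TwoColoredGraph.disjUnion {W W' : Type*} (H : TwoColoredGraph W) (H' : TwoColoredGraph W') :
    TwoColoredGraph (W ⊕ W') where
  solid := SimpleGraph.sum H.solid H'.solid
  dotted := SimpleGraph.sum H.dotted H'.dotted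

/-- The defect graph of `(V, F)` (relative to `lam`) is isomorphic to `H`: it has no edges at
levels other than `1` and `-1`, and some bijection of the vertices carries the solid edges of `H`
to the level `1` edges and the dotted edges of `H` to the level `-1` edges. -/
def DefectGraphIso {V W : Type*} [DecidableEq V] (F : Multiset (Finset V)) (lam : ℤ)
    (H : TwoColoredGraph W) : Prop :=
  (∀ i : ℤ, i ≠ 0 → i ≠ 1 → i ≠ -1 → defectGraph F lam i = ⊥) ∧
    ∃ e : W ≃ V, ∀ x y : W,
      ((defectGraph F lam 1).Adj (e x) (e y) ↔ H.solid.Adj x y) ∧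
      ((defectGraph F lam (-1)).Adj (e x) (e y) ↔ H.dotted.Adj x y)

/-- The defect graph is isomorphic to `H⁰_{v,ε}`: a perfect matching with `(v + 2 ε) / 4` solid
and `(v - 2 ε) / 4` dotted edges. -/
def HasDefectH0 {V : Type*} [DecidableEq V] (F : Multiset (Finset V)) (v : ℕ) (lam eps : ℤ) :
    Prop :=
  ∃ p q : ℕ, 4 * (p : ℤ) = v + 2 * eps ∧ 4 * (q : ℤ) = v - 2 * eps ∧
    DefectGraphIso F lam (matchingGraph p q)

/-- The defect graph is isomorphic to `H¹_{v,ε}`: a star with two solid edges and one dotted edge,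
together with `(v - 6 + 2 ε) / 4` solid and `(v - 2 - 2 ε) / 4` dotted independent edges. -/
def HasDefectH1 {V : Type*} [DecidableEq V] (F : Multiset (Finset V)) (v : ℕ) (lam eps : ℤ) :
    Prop :=
  ∃ p q : ℕ, 4 * (p : ℤ) = v - 6 + 2 * eps ∧ 4 * (q : ℤ) = v - 2 - 2 * eps ∧
    DefectGraphIso F lam (starTwoSolid.disjUnion (matchingGraph p q))

/-- The defect graph is isomorphic to `H²_{v,ε}`: a star with one solid edge and two dotted edges,
together with `(v - 2 + 2 ε) / 4` solid and `(v - 6 - 2 ε) / 4` dotted independent edges. -/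
def HasDefectH2 {V : Type*} [DecidableEq V] (F : Multiset (Finset V)) (v : ℕ) (lam eps : ℤ) :
    Prop :=
  ∃ p q : ℕ, 4 * (p : ℤ) = v - 2 + 2 * eps ∧ 4 * (q : ℤ) = v - 6 - 2 * eps ∧
    DefectGraphIso F lam (starOneSolid.disjUnion (matchingGraph p q))

/-- A triple system with `v` points and `b` blocks, `(v, b)` satisfying (C2), is nearly
2-balanced. -/
def IsNearlyTwoBalanced {V : Type*} [DecidableEq V] (F : Multiset (Finset V)) (v b : ℕ) : Prop :=
  SatisfiesC2 v b ∧ ∃ lam eps : ℤ, Odd lam ∧ IsAssociated v b lam eps ∧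
    (eps ≡ ((v / 2 : ℕ) : ℤ) [ZMOD 2] → HasDefectH0 F v lam eps) ∧
    (¬ eps ≡ ((v / 2 : ℕ) : ℤ) [ZMOD 2] → HasDefectH1 F v lam eps ∨ HasDefectH2 F v lam eps)

/-- `(V, F)` is an NWBTS`(v; b)` (nearly well-balanced triple system), for parameters satisfying
(C2): a triple system with `v` points and `b` blocks that is nearly 2-balanced and 3-balanced. -/
def IsNWBTS {V : Type*} [Fintype V] [DecidableEq V] (F : Multiset (Finset V)) (v b : ℕ) : Prop :=
  Fintype.card V = v ∧ IsTripleSystem F b ∧ IsNearlyTwoBalanced F v b ∧ IsBalanced F 3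

end TripleSystems

/-!
Let `v = 6 t` and `b = lam * t * (6 t - 1) + d` with `lam` odd and `|d| < t`. Removing copies of
the set of all triples reduces `lam` to an odd number below `6 t - 2`. The remaining triple
system has no repeated blocks and is encoded by a symmetric ternary relation on the points; it is
automatically 3-balanced, and its number of blocks follows from its pair degrees
(`exists_isBalanced_of_realizes`).

The points are arranged in three columns, each a copy of `ZMod t × ZMod 2`, whose first
coordinate splits a column into holes of size two. A commutative quasigroup on `ZMod t × ZMod 2`
that induces the group `ZMod 2` on each hole (`exists_isHoley_of_odd`, `exists_isHoley_of_even`)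
gives blocks `{(x, i), (y, i), (x ∘ y, i + 1)}`, with `x` and `y` in different holes, that cover
every pair of points over different elements of `ZMod t` exactly once. What is left are the `t`
sets of six points over the elements `a` of `ZMod t`. On such a set, four transversal blocks
leave the three pairs inside a column uncovered, while six blocks with two points in one column
cover those pairs twice; both choices cover the other pairs once. Choosing the second option for
`a` in a set `K` yields a matching with `3 |K|` solid and `3 (t - |K|)` dotted edges, hence `d =
2 |K| - t`. One additional block on one of the sets outside `K` creates the star and reaches the
other parity of `d` (`IsBase.realizes_matchingGraph`, `IsBase.realizes_star`).

Larger `lam` are obtained by adding disjoint twofold designs, which consist of shifted copies of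
the quasigroup blocks and of transversals (`exists_isBase_of_isShiftSet`). There are enough of
them for `lam ≤ 3 t - 1` (`exists_isBase_of_le`), and complementation in the set of all triples
replaces `lam` by `6 t - 2 - lam` and `d` by `-d`. The quasigroup does not exist for `t = 2`,
where explicit systems with `lam = 1, 3, 5` are used instead (`exists_valid_cyclicSystem`).
-/

namespace TripleSystems


/-! ### Symmetric ternary relations as simple triple systems -/

/-- A ternary relation invariant under all permutations of its arguments. Restricted to pairwise
distinct arguments, it encodes a triple system without repeated blocks. -/
structure IsSymmetricTernary {V : Type*} (T : V → V → V → Prop) : Prop where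
  swap_left : ∀ {p q z}, T p q z → T q p z
  swap_right : ∀ {p q z}, T p q z → T p z q

/-- The number of blocks of the triple system encoded by `T` that contain both `p` and `q`. -/
noncomputable def pairDegree {V : Type*} (T : V → V → V → Prop) (p q : V) : ℕ :=
  {z | z ≠ p ∧ z ≠ q ∧ T p q z}.ncard

open Classical in
/-- The three-element sets encoded by `T`. -/
noncomputable def blocks {V : Type*} [Fintype V] (T : V → V → V → Prop) : Finset (Finset V) :=
  Finset.univ.filter fun S =>
    S.card = 3 ∧ ∀ p ∈ S, ∀ q ∈ S, ∀ z ∈ S, p ≠ q → p ≠ z → q ≠ z → T p q z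

theorem pairDegree_eq_card {V : Type*} {T : V → V → V → Prop} {p q : V}
    (s : Finset V) (hs : ∀ z, z ∈ s ↔ z ≠ p ∧ z ≠ q ∧ T p q z) : pairDegree T p q = s.card := by
  rw [pairDegree, ← Set.ncard_coe_finset]
  congr 1
  ext z
  exact (hs z).symm

theorem mem_blocks {V : Type*} [Fintype V] {T : V → V → V → Prop} {S : Finset V} :
    S ∈ blocks T ↔
      S.card = 3 ∧ ∀ p ∈ S, ∀ q ∈ S, ∀ z ∈ S, p ≠ q → p ≠ z → q ≠ z → T p q z := by
  simp only [blocks, Finset.mem_filter, Finset.mem_univ, true_and]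

theorem card_eq_three_of_mem_blocks {V : Type*} [Fintype V] {T : V → V → V → Prop} {S : Finset V}
    (h : S ∈ blocks T) : S.card = 3 :=
  (mem_blocks.1 h).1

theorem mem_blocks_iff {V : Type*} [Fintype V] [DecidableEq V] {T : V → V → V → Prop}
    (hT : IsSymmetricTernary T) {p q z : V} (hpq : p ≠ q) (hpz : p ≠ z) (hqz : q ≠ z) :
    {p, q, z} ∈ blocks T ↔ T p q z := by
  constructor
  · intro h
    exact (mem_blocks.1 h).2 p (by simp) q (by simp) z (by simp) hpq hpz hqz
  · intro h
    have h1 := hT.swap_left h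
    have h2 := hT.swap_right h
    have h3 := hT.swap_right h1
    have h4 := hT.swap_left h2
    have h5 := hT.swap_left h3
    refine mem_blocks.2 ⟨Finset.card_eq_three.2 ⟨p, q, z, hpq, hpz, hqz, rfl⟩, ?_⟩
    simp only [Finset.mem_insert, Finset.mem_singleton]
    rintro a (rfl | rfl | rfl) b (rfl | rfl | rfl) c (rfl | rfl | rfl) hab hac hbc <;>
      first | contradiction | assumption

theorem pairDegree_comm {V : Type*} {T : V → V → V → Prop}
    (hT : IsSymmetricTernary T) (p q : V) : pairDegree T p q = pairDegree T q p := by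
  rw [pairDegree, pairDegree]
  congr 1
  ext z
  exact ⟨fun h => ⟨h.2.1, h.1, hT.swap_left h.2.2⟩, fun h => ⟨h.2.1, h.1, hT.swap_left h.2.2⟩⟩

theorem blockCount_pair_blocks {V : Type*} [Fintype V] [DecidableEq V] {T : V → V → V → Prop}
    (hT : IsSymmetricTernary T) {p q : V} (hpq : p ≠ q) :
    blockCount (blocks T).val {p, q} = pairDegree T p q := by
  classical
  have h : blockCount (blocks T).val {p, q} = ((blocks T).filter fun B => {p, q} ⊆ B).card := by
    rw [blockCount, Multiset.countP_eq_card_filter]; rfl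
  rw [h, pairDegree_eq_card (Finset.univ.filter fun z => z ≠ p ∧ z ≠ q ∧ T p q z)
    fun z => by rw [Finset.mem_filter_univ]]
  symm
  refine Finset.card_bij (fun z _ => {p, q, z}) ?_ ?_ ?_
  · intro z hz
    obtain ⟨hzp, hzq, hz⟩ := (Finset.mem_filter.1 hz).2
    refine Finset.mem_filter.2 ⟨(mem_blocks_iff hT hpq hzp.symm hzq.symm).2 hz, ?_⟩
    intro x hx
    simp only [Finset.mem_insert, Finset.mem_singleton] at hx ⊢
    tauto
  · intro z hz z' _ h
    obtain ⟨hzp, hzq, _⟩ := (Finset.mem_filter.1 hz).2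
    have h' : z ∈ ({p, q, z'} : Finset V) := h ▸ (by simp)
    simp only [Finset.mem_insert, Finset.mem_singleton] at h'
    tauto
  · intro S hS
    obtain ⟨hS, hsub⟩ := Finset.mem_filter.1 hS
    have hp : p ∈ S := hsub (by simp)
    have hq : q ∈ S := hsub (by simp)
    have h1 : ((S.erase p).erase q).card = 1 := by
      rw [Finset.card_erase_of_mem (by simp [hq, hpq.symm]), Finset.card_erase_of_mem hp,
        card_eq_three_of_mem_blocks hS]
    obtain ⟨z, hz⟩ := Finset.card_eq_one.1 h1
    have hz' : z ∈ (S.erase p).erase q := by simp [hz]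
    simp only [Finset.mem_erase] at hz'
    have hSeq : {p, q, z} = S := by
      rw [← Finset.insert_erase hp, ← Finset.insert_erase (Finset.mem_erase.2 ⟨hpq.symm, hq⟩), hz]
    refine ⟨z, Finset.mem_filter.2 ⟨Finset.mem_univ _, hz'.2.1, hz'.1, ?_⟩, hSeq⟩
    rw [← mem_blocks_iff hT hpq hz'.2.1.symm hz'.1.symm, hSeq]
    exact hS

theorem blockCount_blocks_of_card_eq_three {V : Type*} [Fintype V] [DecidableEq V]
    (T : V → V → V → Prop) {S : Finset V} (hS : S.card = 3) :
    blockCount (blocks T).val S = if S ∈ blocks T then 1 else 0 := by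
  classical
  have h : blockCount (blocks T).val S = ((blocks T).filter fun B => S ⊆ B).card := by
    rw [blockCount, Multiset.countP_eq_card_filter]; rfl
  have h2 : ((blocks T).filter fun B => S ⊆ B) = (blocks T).filter fun B => S = B := by
    refine Finset.filter_congr fun B hB => ⟨fun hsub => ?_, fun h => h ▸ subset_rfl⟩
    exact Finset.eq_of_subset_of_card_le hsub (by rw [hS, card_eq_three_of_mem_blocks hB])
  rw [h, h2, Finset.filter_eq]
  split_ifs <;> simp

theorem pairDegree_true {V : Type*} [Fintype V] {p q : V} (hpq : p ≠ q) :
    pairDegree (fun _ _ _ : V => True) p q + 2 = Fintype.card V := by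
  classical
  have h2 : 2 ≤ Fintype.card V := by
    have := Finset.card_le_univ ({p, q} : Finset V)
    rwa [Finset.card_pair hpq] at this
  rw [pairDegree_eq_card ((Finset.univ.erase p).erase q) fun z => by simp; tauto,
    Finset.card_erase_of_mem (by simp [hpq.symm]),
    Finset.card_erase_of_mem (by simp), Finset.card_univ]
  omega

theorem pairDegree_add_pairDegree_not {V : Type*} [Fintype V] (T : V → V → V → Prop) {p q : V}
    (hpq : p ≠ q) :
    pairDegree T p q + pairDegree (fun a b c => ¬ T a b c) p q + 2 = Fintype.card V := by
  classical
  rw [← pairDegree_true hpq, pairDegree, pairDegree, pairDegree, ← Set.ncard_union_eq]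
  · congr 2
    ext z
    simp only [Set.mem_union, Set.mem_ofPred_eq]
    tauto
  · rw [Set.disjoint_left]
    exact fun z h h' => h'.2.2 h.2.2

theorem pairDegree_equiv {V W : Type*} (e : W ≃ V) (T : W → W → W → Prop) (x y : W) :
    pairDegree (fun a b c => T (e.symm a) (e.symm b) (e.symm c)) (e x) (e y)
      = pairDegree T x y := by
  rw [pairDegree, pairDegree, ← Set.ncard_image_of_injective _ e.injective]
  congr 1
  ext z
  simp [← Equiv.symm_apply_eq]

/-! ### Two-coloured graphs realised by simple triple systems -/

namespace TwoColoredGraph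

open Classical in
/-- The deviation prescribed by `H` at a pair of vertices: `1` on solid edges, `-1` on dotted
edges, `0` elsewhere. -/
noncomputable def defect {W : Type*} (H : TwoColoredGraph W) (x y : W) : ℤ :=
  (if H.solid.Adj x y then 1 else 0) - (if H.dotted.Adj x y then 1 else 0)

/-- The graph with solid and dotted edges exchanged. -/
def swap {W : Type*} (H : TwoColoredGraph W) : TwoColoredGraph W := ⟨H.dotted, H.solid⟩

theorem defect_swap {W : Type*} (H : TwoColoredGraph W) (x y : W) :
    H.swap.defect x y = - H.defect x y := by
  rw [defect, defect, neg_sub]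
  rfl

theorem defect_self {W : Type*} (H : TwoColoredGraph W) (x : W) : H.defect x x = 0 := by
  simp [defect]

end TwoColoredGraph

/-- Some triple system without repeated blocks on the vertices of `H` covers each pair `lam` times,
corrected by the deviation that `H` prescribes. -/
def Realizes {W : Type*} (H : TwoColoredGraph W) (lam : ℤ) : Prop :=
  ∃ T : W → W → W → Prop, IsSymmetricTernary T ∧
    ∀ x y, x ≠ y → (pairDegree T x y : ℤ) = lam + H.defect x y

theorem Realizes.of_equiv {W V : Type*} {H : TwoColoredGraph W} {lam : ℤ}
    {T : V → V → V → Prop} (hT : IsSymmetricTernary T) (e : W ≃ V)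
    (h : ∀ x y, x ≠ y → (pairDegree T (e x) (e y) : ℤ) = lam + H.defect x y) :
    Realizes H lam := by
  refine ⟨fun a b c => T (e a) (e b) (e c), ⟨fun h => hT.swap_left h, fun h => hT.swap_right h⟩,
    fun x y hxy => ?_⟩
  have := pairDegree_equiv e.symm T (e x) (e y)
  simp only [Equiv.symm_symm, Equiv.symm_apply_apply] at this
  rw [this, h x y hxy]

theorem Realizes.transport {W W' : Type*} {H : TwoColoredGraph W}
    {H' : TwoColoredGraph W'} {lam : ℤ} (h : Realizes H lam) (e : W' ≃ W)
    (hd : ∀ x y, H'.defect x y = H.defect (e x) (e y)) : Realizes H' lam := by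
  obtain ⟨T, hT, h⟩ := h
  exact Realizes.of_equiv hT e fun x y hxy => by rw [h _ _ (e.injective.ne hxy), hd]

/-- Complementation in the set of all triples. -/
theorem Realizes.swap {W : Type*} [Fintype W] {H : TwoColoredGraph W} {lam : ℤ}
    (h : Realizes H lam) : Realizes H.swap (Fintype.card W - 2 - lam) := by
  obtain ⟨T, hT, h⟩ := h
  refine ⟨fun a b c => ¬ T a b c,
    ⟨fun h h' => h (hT.swap_left h'), fun h h' => h (hT.swap_right h')⟩,
    fun x y hxy => ?_⟩
  have h1 := pairDegree_add_pairDegree_not T hxy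
  have h2 := h x y hxy
  rw [TwoColoredGraph.defect_swap]
  omega

theorem sum_blockCount_offDiag {V : Type*} [Fintype V] [DecidableEq V] (F : Multiset (Finset V))
    (hF : ∀ B ∈ F, B.card = 3) :
    ∑ x ∈ (Finset.univ : Finset V).offDiag, blockCount F {x.1, x.2} = 6 * F.card := by
  induction F using Multiset.induction_on with
  | empty => simp [blockCount]
  | cons B F ih =>
    have h1 : ∀ x : V × V, blockCount (B ::ₘ F) {x.1, x.2}
        = blockCount F {x.1, x.2} + if {x.1, x.2} ⊆ B then 1 else 0 := fun x => by
      rw [blockCount, Multiset.countP_cons]; rfl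
    have h2 : ((Finset.univ : Finset V).offDiag.filter fun x => {x.1, x.2} ⊆ B) = B.offDiag := by
      ext x
      simp [Finset.insert_subset_iff]
      tauto
    simp_rw [h1]
    rw [Finset.sum_add_distrib, ih fun B' hB' => hF B' (Multiset.mem_cons_of_mem hB'),
      ← Finset.card_filter, h2, Finset.offDiag_card, hF B (Multiset.mem_cons_self _ _)]
    simp; ring

/-- A simple triple system realising `H`, together with `m` copies of the set of all triples, is a
3-balanced triple system with defect graph `H`. -/
theorem exists_isBalanced_of_realizes {W : Type*} [Fintype W] {H : TwoColoredGraph W}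
    {v b m : ℕ} {lam mu eps : ℤ} (hW : Fintype.card W = v) (h : Realizes H mu)
    (hlam : lam = m * (v - 2) + mu) (hdisj : ∀ x y, H.solid.Adj x y → ¬ H.dotted.Adj x y)
    (hsum : ∑ x, ∑ y, H.defect x y = 2 * eps) (hb : 3 * (b : ℤ) = lam * (v.choose 2 : ℤ) + eps) :
    ∃ F : Multiset (Finset (Fin v)), IsTripleSystem F b ∧ IsBalanced F 3 ∧
      DefectGraphIso F lam H := by
  classical
  obtain ⟨T, hT, hdeg⟩ := h
  let e : W ≃ Fin v := Fintype.equivFinOfCardEq hW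
  let T' : Fin v → Fin v → Fin v → Prop := fun a b c => T (e.symm a) (e.symm b) (e.symm c)
  have hT' : IsSymmetricTernary T' := ⟨fun h => hT.swap_left h, fun h => hT.swap_right h⟩
  have hA : IsSymmetricTernary (fun _ _ _ : Fin v => True) := ⟨fun _ => trivial, fun _ => trivial⟩
  let F : Multiset (Finset (Fin v)) :=
    m • (blocks fun _ _ _ : Fin v => True).val + (blocks T').val
  have hcount : ∀ S, blockCount F S
      = m * blockCount (blocks fun _ _ _ : Fin v => True).val S + blockCount (blocks T').val S := by
    intro S
    simp [F, blockCount, Multiset.countP_add, Multiset.countP_nsmul]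
  have hF3 : ∀ B ∈ F, B.card = 3 := by
    intro B hB
    rcases Multiset.mem_add.1 hB with hB | hB
    · exact card_eq_three_of_mem_blocks (Multiset.mem_of_mem_nsmul hB)
    · exact card_eq_three_of_mem_blocks (T := T') hB
  have hpair : ∀ x y, x ≠ y → (blockCount F {e x, e y} : ℤ) = lam + H.defect x y := by
    intro x y hxy
    have hxy' : e x ≠ e y := e.injective.ne hxy
    have h1 := pairDegree_true hxy'
    rw [Fintype.card_fin] at h1
    rw [hcount, blockCount_pair_blocks hA hxy', blockCount_pair_blocks hT' hxy',
      pairDegree_equiv e T x y]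
    push_cast
    rw [hdeg x y hxy, hlam]
    have h2 : (pairDegree (fun _ _ _ : Fin v => True) (e x) (e y) : ℤ) = v - 2 := by omega
    rw [h2]; ring
  refine ⟨F, ⟨?_, hF3⟩, ?_, ?_, e, ?_⟩
  · have h1 := sum_blockCount_offDiag F hF3
    have h2 : (∑ x ∈ (Finset.univ : Finset (Fin v)).offDiag, (blockCount F {x.1, x.2} : ℤ))
        = ∑ x ∈ (Finset.univ : Finset W).offDiag, (lam + H.defect x.1 x.2) := by
      symm
      refine Finset.sum_equiv (e.prodCongr e) (fun x => ?_) fun x hx => ?_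
      · simp
      · rw [Finset.mem_offDiag] at hx
        exact (hpair x.1 x.2 hx.2.2).symm
    have h3 : ∑ x ∈ (Finset.univ : Finset W).offDiag, H.defect x.1 x.2 = 2 * eps := by
      rw [← hsum, ← Fintype.sum_prod_type']
      refine Finset.sum_subset (Finset.subset_univ _) fun x _ hx => ?_
      have : x.1 = x.2 := by simpa using hx
      rw [this, TwoColoredGraph.defect_self]
    rw [Finset.sum_add_distrib, h3, Finset.sum_const, Finset.offDiag_card, Finset.card_univ,
      hW] at h2
    have h4 : 2 * (v.choose 2 : ℤ) = ((v * v - v : ℕ) : ℤ) := by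
      have := Nat.choose_two_right v
      have h5 : 2 ∣ v * (v - 1) := (Nat.even_mul_pred_self v).two_dvd
      have h6 : v * (v - 1) = v * v - v := by rw [Nat.mul_sub, mul_one]
      rw [← h6]
      exact_mod_cast (by omega : 2 * v.choose 2 = v * (v - 1))
    have h7 : ((6 * F.card : ℕ) : ℤ) = 6 * b := by
      rw [← h1]; push_cast
      rw [h2, nsmul_eq_mul, ← h4]
      linear_combination -2 * hb
    omega
  · intro S S' hS hS'
    have h1 : ∀ S : Finset (Fin v), S.card = 3 → S ∈ blocks fun _ _ _ : Fin v => True := by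
      intro S hS
      simp [blocks, hS]
    rw [hcount, hcount, blockCount_blocks_of_card_eq_three _ hS,
      blockCount_blocks_of_card_eq_three _ hS', blockCount_blocks_of_card_eq_three _ hS,
      blockCount_blocks_of_card_eq_three _ hS', if_pos (h1 S hS), if_pos (h1 S' hS')]
    split_ifs <;> simp
  · intro i h0 h1 hm1
    rw [eq_bot_iff]
    intro x y hxy
    obtain ⟨x, rfl⟩ := e.surjective x
    obtain ⟨y, rfl⟩ := e.surjective y
    have h2 := hpair x y fun h => hxy.1 (h ▸ rfl)
    have h3 := hxy.2
    rw [h2, TwoColoredGraph.defect] at h3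
    exfalso
    split_ifs at h3 <;> omega
  · intro x y
    by_cases hxy : x = y
    · subst hxy; simp
    have h1 := hpair x y hxy
    have h2 := hdisj x y
    have hne : e x ≠ e y := e.injective.ne hxy
    rw [TwoColoredGraph.defect] at h1
    constructor
    · change (e x ≠ e y ∧ (blockCount F {e x, e y} : ℤ) = lam + 1) ↔ _
      rw [h1]
      split_ifs <;> simp_all
    · change (e x ≠ e y ∧ (blockCount F {e x, e y} : ℤ) = lam + -1) ↔ _
      rw [h1]
      split_ifs <;> simp_all


/-! ### Commutative quasigroups with holes of size two -/

/-- A commutative quasigroup on `A × ZMod 2` in which every hole `{a} × ZMod 2` is a subquasigroup,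
with operation inherited from `ZMod 2`. -/
structure IsHoley {A : Type*} (op : A × ZMod 2 → A × ZMod 2 → A × ZMod 2) : Prop where
  comm : ∀ x y, op x y = op y x
  inj : ∀ x, Function.Injective (op x)
  hole : ∀ a b b', op (a, b) (a, b') = (a, b + b')

theorem IsHoley.transport {A X : Type*} {op : X → X → X} (e : X ≃ A × ZMod 2)
    (comm : ∀ x y, op x y = op y x) (inj : ∀ x, Function.Injective (op x))
    (hole : ∀ x y, (e x).1 = (e y).1 → e (op x y) = ((e x).1, (e x).2 + (e y).2)) :
    IsHoley (fun x y => e (op (e.symm x) (e.symm y))) where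
  comm x y := by rw [comm]
  inj x := e.injective.comp ((inj _).comp e.symm.injective)
  hole a b b' := by
    have := hole (e.symm (a, b)) (e.symm (a, b'))
    simpa using this

/-- For odd `t`, the first coordinates carry the idempotent operation `(a + a') / 2`. -/
theorem exists_isHoley_of_odd {t : ℕ} (ht : Odd t) :
    ∃ op : ZMod t × ZMod 2 → ZMod t × ZMod 2 → ZMod t × ZMod 2, IsHoley op := by
  obtain ⟨k, rfl⟩ := ht
  have h2 : ((k + 1 : ℕ) : ZMod (2 * k + 1)) * 2 = 1 := by
    have : ((2 * k + 1 : ℕ) : ZMod (2 * k + 1)) = 0 := ZMod.natCast_self _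
    push_cast at this ⊢
    linear_combination this
  refine ⟨fun x y => (((k + 1 : ℕ) : ZMod (2 * k + 1)) * (x.1 + y.1), x.2 + y.2),
    fun x y => ?_, fun x y z h => ?_, fun a b b' => ?_⟩
  · simp [add_comm]
  · obtain ⟨h1, h3⟩ := Prod.ext_iff.1 h
    refine Prod.ext ?_ (add_left_cancel h3)
    refine add_left_cancel (a := x.1) ?_
    simp only at h1
    linear_combination 2 * h1 - (y.1 - z.1) * h2
  · refine Prod.ext ?_ rfl
    simp only
    linear_combination a * h2

/-- The offsets of the holey quasigroup of order `4 k + 4`. The pairs `{g d, g d - d}`, with `d` up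
to sign different from `0`, `1` and `2 k + 1`, partition the residues modulo `4 k + 2` other than
`0`, `2 k + 1`, `k` and `4 k + 1`. -/
def holeyOffset (k d : ℕ) : ℕ :=
  if d = 2 * k then 3 * k + 1
  else if d = 2 * k + 2 then k + 1
  else if d % 2 = 1 then (if d < 2 * k + 1 then (2 * k + 1 + d) / 2 else (d - (2 * k + 1)) / 2)
  else if d < 2 * k + 1 then 3 * k + 1 + d / 2 else k + d / 2

theorem holeyOffset_inj {k d d' : ℕ} (hd : 2 ≤ d) (hd2 : d ≤ 4 * k)
    (hd' : 2 ≤ d') (hd2' : d' ≤ 4 * k) (h : holeyOffset k d = holeyOffset k d') : d = d' := by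
  unfold holeyOffset at h
  split_ifs at h <;> omega

theorem holeyOffset_bounds {k d : ℕ} (hk : 1 ≤ k) (hd : 2 ≤ d) (hd2 : d ≤ 4 * k)
    (hdn : d ≠ 2 * k + 1) :
    0 < holeyOffset k d ∧ holeyOffset k d < 4 * k + 1 ∧ holeyOffset k d ≠ k ∧
      holeyOffset k d ≠ 2 * k + 1 := by
  unfold holeyOffset
  split_ifs <;> omega

theorem holeyOffset_neg {k d : ℕ} (hd : 2 ≤ d) (hd2 : d ≤ 4 * k) (hdn : d ≠ 2 * k + 1) :
    holeyOffset k d = holeyOffset k (4 * k + 2 - d) + d ∨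
      holeyOffset k d + (4 * k + 2) = holeyOffset k (4 * k + 2 - d) + d := by
  unfold holeyOffset
  split_ifs <;> omega

/-- The label of `x ∘ y`, for a residue `x` modulo `4 k + 2` of parity `e` and a residue `y` with
`y - x` represented by `d`. A label `c < 4 k + 2` stands for the residue `x + c`, the labels `4 k
+ 2` and `4 k + 3` for the two points at infinity. -/
def holeyLabel (k : ℕ) (e : ZMod 2) (d : ℕ) : ℕ :=
  if d = 0 then (if e = 0 then 0 else 2 * k + 1)
  else if d = 2 * k + 1 then (if e = 0 then 2 * k + 1 else 0)
  else if d = 1 then (if e = 0 then 4 * k + 2 else 4 * k + 3)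
  else if d = 4 * k + 1 then (if e = 0 then 4 * k + 3 else 4 * k + 2)
  else holeyOffset k d

/-- The label of the product of a residue with the point at infinity `b`. -/
def holeyLabelInfty (k : ℕ) (b : ZMod 2) : ℕ := if b = 0 then k else 4 * k + 1

theorem holeyLabel_inj {k : ℕ} (hk : 1 ≤ k) {e : ZMod 2} {d d' : ℕ} (hd : d < 4 * k + 2)
    (hd' : d' < 4 * k + 2) (h : holeyLabel k e d = holeyLabel k e d') : d = d' := by
  have hb : ∀ d, d < 4 * k + 2 → d ≠ 0 → d ≠ 2 * k + 1 → d ≠ 1 → d ≠ 4 * k + 1 →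
      0 < holeyOffset k d ∧ holeyOffset k d < 4 * k + 1 ∧ holeyOffset k d ≠ 2 * k + 1 := by
    intro d hd h0 hn h1 h2
    obtain ⟨h3, h4, -, h5⟩ := holeyOffset_bounds hk (d := d) (by omega) (by omega) hn
    exact ⟨h3, h4, h5⟩
  have hb1 := hb d hd
  have hb2 := hb d' hd'
  by_cases hg : (d ≠ 0 ∧ d ≠ 2 * k + 1 ∧ d ≠ 1 ∧ d ≠ 4 * k + 1) ∧
      (d' ≠ 0 ∧ d' ≠ 2 * k + 1 ∧ d' ≠ 1 ∧ d' ≠ 4 * k + 1)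
  · simp only [holeyLabel, hg.1.1, hg.1.2.1, hg.1.2.2.1, hg.1.2.2.2, hg.2.1, hg.2.2.1,
      hg.2.2.2.1, hg.2.2.2.2, if_false] at h
    exact holeyOffset_inj (by omega) (by omega) (by omega) (by omega) h
  · unfold holeyLabel at h
    generalize holeyOffset k d = g at *
    generalize holeyOffset k d' = g' at *
    split_ifs at h <;> omega

theorem holeyLabel_ne_holeyLabelInfty {k : ℕ} (hk : 1 ≤ k) {e b : ZMod 2} {d : ℕ}
    (hd : d < 4 * k + 2) : holeyLabel k e d ≠ holeyLabelInfty k b := by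
  intro h
  have hb := holeyOffset_bounds hk (d := d)
  unfold holeyLabel holeyLabelInfty at h
  generalize holeyOffset k d = g at *
  split_ifs at h <;> omega

theorem holeyLabel_lt {k : ℕ} (hk : 1 ≤ k) {e : ZMod 2} {d : ℕ} (hd : d < 4 * k + 2) :
    holeyLabel k e d < 4 * k + 4 := by
  have hb := holeyOffset_bounds hk (d := d)
  unfold holeyLabel
  generalize holeyOffset k d = g at *
  split_ifs <;> omega

/-- The element with label `c` relative to the residue `x`. -/
def holeyDecode (k : ℕ) (x : ZMod (4 * k + 2)) (c : ℕ) : ZMod (4 * k + 2) ⊕ ZMod 2 :=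
  if c < 4 * k + 2 then Sum.inl (x + c) else Sum.inr ((c - (4 * k + 2) : ℕ) : ZMod 2)

theorem holeyDecode_inj {k : ℕ} {x : ZMod (4 * k + 2)} {c c' : ℕ} (hc : c < 4 * k + 4)
    (hc' : c' < 4 * k + 4) (h : holeyDecode k x c = holeyDecode k x c') : c = c' := by
  unfold holeyDecode at h
  split_ifs at h with h1 h2 h2
  · have h3 := (ZMod.natCast_eq_natCast_iff' _ _ _).1 (add_left_cancel (Sum.inl_injective h))
    rwa [Nat.mod_eq_of_lt h1, Nat.mod_eq_of_lt h2] at h3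
  · have h3 := (ZMod.natCast_eq_natCast_iff' _ _ _).1 (Sum.inr_injective h)
    omega

/-- The commutative quasigroup of order `4 k + 4` with holes of size two, on the residues modulo
`4 k + 2` and two points at infinity. -/
def holeyOp (k : ℕ) :
    ZMod (4 * k + 2) ⊕ ZMod 2 → ZMod (4 * k + 2) ⊕ ZMod 2 → ZMod (4 * k + 2) ⊕ ZMod 2
  | .inl x, .inl y => holeyDecode k x (holeyLabel k (x.val : ZMod 2) (y - x).val)
  | .inl x, .inr b => holeyDecode k x (holeyLabelInfty k b)
  | .inr b, .inl x => holeyDecode k x (holeyLabelInfty k b)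
  | .inr b, .inr b' => .inr (b + b')

theorem natCast_val_add (k : ℕ) (x y : ZMod (4 * k + 2)) :
    (((x + y).val : ℕ) : ZMod 2) = x.val + y.val := by
  have h : (2 : ℕ) ∣ 4 * k + 2 := by omega
  simp only [ZMod.natCast_val]
  exact map_add (ZMod.castHom h (ZMod 2)) x y

theorem natCast_two_mul_add_one (k : ℕ) : ((2 * k + 1 : ℕ) : ZMod 2) = 1 :=
  (ZMod.natCast_eq_one_iff_odd).2 ⟨k, rfl⟩

theorem holeyOp_comm {k : ℕ} (hk : 1 ≤ k) (x y : ZMod (4 * k + 2) ⊕ ZMod 2) :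
    holeyOp k x y = holeyOp k y x := by
  rcases x with x | b <;> rcases y with y | b'
  · by_cases hxy : x = y
    · rw [hxy]
    have hd0 : (y - x).val ≠ 0 := by
      rw [Ne, ZMod.val_eq_zero, sub_eq_zero]; exact fun h => hxy h.symm
    have hdlt := ZMod.val_lt (y - x)
    have hneg : (x - y).val = 4 * k + 2 - (y - x).val := by
      have : NeZero (y - x) := ⟨sub_ne_zero.2 fun h => hxy h.symm⟩
      rw [← neg_sub, ZMod.val_neg_of_ne_zero]
    have hy : y = x + ((y - x).val : ℕ) := by
      rw [ZMod.natCast_val, ZMod.cast_id]; ring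
    have hpar : (y.val : ZMod 2) = x.val + ((y - x).val : ℕ) := by
      rw [← natCast_val_add]; congr 2; ring
    have hN : ((4 * k + 2 : ℕ) : ZMod (4 * k + 2)) = 0 := ZMod.natCast_self _
    have h01 : (x.val : ZMod 2) = 0 ∨ (x.val : ZMod 2) = 1 := by
      generalize (x.val : ZMod 2) = e
      revert e; decide
    change holeyDecode k x (holeyLabel k (x.val : ZMod 2) (y - x).val)
      = holeyDecode k y (holeyLabel k (y.val : ZMod 2) (x - y).val)
    rw [hneg, hpar]
    generalize (x.val : ZMod 2) = e at *
    generalize (y - x).val = d at *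
    subst hy
    by_cases hn : d = 2 * k + 1
    · subst hn
      have h2 := natCast_two_mul_add_one k
      have h3 : 4 * k + 2 - (2 * k + 1) = 2 * k + 1 := by omega
      rw [h2, h3]
      rcases h01 with rfl | rfl
      · simp [holeyLabel, holeyDecode, show 2 * k + 1 < 4 * k + 2 by omega]
      · have h4 : (1 : ZMod 2) + 1 = 0 := rfl
        simp only [holeyLabel, holeyDecode, h4]
        simp [show 2 * k + 1 < 4 * k + 2 by omega]
        push_cast at hN
        linear_combination -hN
    by_cases h1 : d = 1
    · subst h1
      have h3 : 4 * k + 2 - 1 = 4 * k + 1 := by omega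
      have h4 : (1 : ZMod 2) + 1 = 0 := rfl
      rw [h3, Nat.cast_one]
      rcases h01 with rfl | rfl <;>
        simp [holeyLabel, holeyDecode, show k ≠ 0 by omega, show 4 * k ≠ 2 * k by omega, h4]
    by_cases h2 : d = 4 * k + 1
    · subst h2
      have h3 : 4 * k + 2 - (4 * k + 1) = 1 := by omega
      have h4 : (1 : ZMod 2) + 1 = 0 := rfl
      have h5 : ((4 * k + 1 : ℕ) : ZMod 2) = 1 := by
        rw [show 4 * k + 1 = 2 * (2 * k) + 1 by ring, natCast_two_mul_add_one]
      rw [h3, h5]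
      rcases h01 with rfl | rfl <;>
        simp [holeyLabel, holeyDecode, show k ≠ 0 by omega, show 4 * k ≠ 2 * k by omega, h4]
    have hb := holeyOffset_bounds hk (d := d) (by omega) (by omega) hn
    have hb' := holeyOffset_bounds hk (d := 4 * k + 2 - d) (by omega) (by omega) (by omega)
    have hl : ∀ e, holeyLabel k e d = holeyOffset k d := fun e => by
      rw [holeyLabel, if_neg hd0, if_neg hn, if_neg h1, if_neg h2]
    have hl' : ∀ e, holeyLabel k e (4 * k + 2 - d) = holeyOffset k (4 * k + 2 - d) := fun e => by
      rw [holeyLabel, if_neg (by omega), if_neg (by omega), if_neg (by omega), if_neg (by omega)]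
    rw [hl, hl', holeyDecode, holeyDecode, if_pos (by omega), if_pos (by omega), add_assoc]
    congr 2
    rw [← Nat.cast_add]
    rcases holeyOffset_neg (k := k) (d := d) (by omega) (by omega) hn with h | h
    · rw [h, add_comm _ d]
    · rw [add_comm d, ← h, Nat.cast_add, hN, add_zero]
  · rfl
  · rfl
  · exact congrArg Sum.inr (add_comm _ _)

theorem holeyOp_inj {k : ℕ} (hk : 1 ≤ k) (x : ZMod (4 * k + 2) ⊕ ZMod 2) :
    Function.Injective (holeyOp k x) := by
  have hI : ∀ b, holeyLabelInfty k b < 4 * k + 2 := by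
    intro b; unfold holeyLabelInfty; split_ifs <;> omega
  rcases x with x | b
  · rintro (y | b) (y' | b') h
    · have h1 := holeyLabel_inj hk (ZMod.val_lt _) (ZMod.val_lt _)
        (holeyDecode_inj (holeyLabel_lt hk (ZMod.val_lt _)) (holeyLabel_lt hk (ZMod.val_lt _)) h)
      rw [sub_left_injective (ZMod.val_injective _ h1)]
    · exact absurd (holeyDecode_inj (holeyLabel_lt hk (ZMod.val_lt _))
        ((hI _).trans (by omega)) h) (holeyLabel_ne_holeyLabelInfty hk (ZMod.val_lt _))
    · exact absurd (holeyDecode_inj (holeyLabel_lt hk (ZMod.val_lt _))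
        ((hI _).trans (by omega)) h.symm) (holeyLabel_ne_holeyLabelInfty hk (ZMod.val_lt _))
    · have h1 := holeyDecode_inj ((hI _).trans (by omega)) ((hI _).trans (by omega)) h
      unfold holeyLabelInfty at h1
      congr 1
      have : ∀ b b' : ZMod 2, (b = 0 ↔ b' = 0) → b = b' := by decide
      refine this b b' ?_
      split_ifs at h1 with h2 h3 h3 <;> first | (exfalso; omega) | simp [h2, h3]
  · rintro (y | b) (y' | b') h
    · have h2 : holeyDecode k y (holeyLabelInfty k b) = holeyDecode k y' (holeyLabelInfty k b) := h
      rw [holeyDecode, holeyDecode, if_pos (hI b), if_pos (hI b)] at h2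
      rw [add_right_cancel (Sum.inl_injective h2)]
    · have h2 : holeyDecode k y (holeyLabelInfty k b) = .inr _ := h
      rw [holeyDecode, if_pos (hI b)] at h2
      cases h2
    · have h2 : holeyDecode k y' (holeyLabelInfty k _) = .inr _ := h.symm
      rw [holeyDecode, if_pos (hI _)] at h2
      cases h2
    · exact congrArg Sum.inr (add_left_cancel (Sum.inr_injective h))

/-- The hole that contains an element, and its position in the hole. -/
def holeyCoord (k : ℕ) : ZMod (4 * k + 2) ⊕ ZMod 2 → Option (ZMod (2 * k + 1)) × ZMod 2
  | .inl x => (some (x.val : ZMod (2 * k + 1)), (x.val : ZMod 2))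
  | .inr b => (none, b)

theorem natCast_val_eq_natCast_val_iff {k : ℕ} (x y : ZMod (4 * k + 2)) :
    ((x.val : ZMod (2 * k + 1)) = y.val) ↔ ((y - x).val = 0 ∨ (y - x).val = 2 * k + 1) := by
  have h : 2 * k + 1 ∣ 4 * k + 2 := ⟨2, by ring⟩
  have h1 : ((x.val : ZMod (2 * k + 1)) = y.val) ↔ (((y - x).val : ℕ) : ZMod (2 * k + 1)) = 0 := by
    simp only [ZMod.natCast_val]
    have := map_sub (ZMod.castHom h (ZMod (2 * k + 1))) y x
    simp only [ZMod.castHom_apply] at this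
    rw [this, sub_eq_zero, eq_comm]
  have hlt := ZMod.val_lt (y - x)
  rw [h1, ZMod.natCast_eq_zero_iff]
  constructor
  · rintro ⟨c, hc⟩
    have : c < 2 := by
      by_contra! h2
      have := Nat.mul_le_mul_left (2 * k + 1) h2
      omega
    interval_cases c <;> omega
  · rintro (h | h) <;> rw [h]
    exact dvd_zero _

theorem holeyCoord_injective (k : ℕ) : Function.Injective (holeyCoord k) := by
  rintro (x | b) (y | b') h
  · obtain ⟨h1, h2⟩ := Prod.ext_iff.1 h
    have h3 := (natCast_val_eq_natCast_val_iff x y).1 (Option.some_injective _ h1)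
    have hpar : (y.val : ZMod 2) = x.val + ((y - x).val : ℕ) := by
      rw [← natCast_val_add]; congr 2; ring
    have h4 : (x.val : ZMod 2) = y.val := h2
    rw [← h4, left_eq_add, ZMod.natCast_eq_zero_iff] at hpar
    have h5 : (y - x).val = 0 := by omega
    rw [ZMod.val_eq_zero, sub_eq_zero] at h5
    rw [h5]
  · cases (Prod.ext_iff.1 h).1
  · cases (Prod.ext_iff.1 h).1
  · exact congrArg Sum.inr (Prod.ext_iff.1 h).2

theorem holeyCoord_holeyOp {k : ℕ} (x y : ZMod (4 * k + 2) ⊕ ZMod 2)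
    (h : (holeyCoord k x).1 = (holeyCoord k y).1) :
    holeyCoord k (holeyOp k x y)
      = ((holeyCoord k x).1, (holeyCoord k x).2 + (holeyCoord k y).2) := by
  rcases x with x | b <;> rcases y with y | b'
  · have h1 := (natCast_val_eq_natCast_val_iff x y).1 (Option.some_injective _ h)
    have hpar : (y.val : ZMod 2) = x.val + ((y - x).val : ℕ) := by
      rw [← natCast_val_add]; congr 2; ring
    have hval : ((2 * k + 1 : ℕ) : ZMod (4 * k + 2)).val = 2 * k + 1 :=
      ZMod.val_cast_of_lt (by omega)
    have hclass : ((x.val : ℕ) : ZMod (2 * k + 1))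
        = ((x + ((2 * k + 1 : ℕ) : ZMod (4 * k + 2))).val : ℕ) := by
      rw [natCast_val_eq_natCast_val_iff]
      right
      rw [add_sub_cancel_left, hval]
    have hshift : ((x + ((2 * k + 1 : ℕ) : ZMod (4 * k + 2))).val : ZMod 2) = x.val + 1 := by
      rw [natCast_val_add, hval, natCast_two_mul_add_one]
    have h01 : (x.val : ZMod 2) = 0 ∨ (x.val : ZMod 2) = 1 := by
      generalize (x.val : ZMod 2) = e
      revert e; decide
    have h4 : (1 : ZMod 2) + 1 = 0 := rfl
    change holeyCoord k (holeyDecode k x (holeyLabel k (x.val : ZMod 2) (y - x).val))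
      = (some (x.val : ZMod (2 * k + 1)), (x.val : ZMod 2) + (y.val : ZMod 2))
    have hA : holeyDecode k x 0 = .inl x := by simp [holeyDecode]
    have hB : holeyDecode k x (2 * k + 1) = .inl (x + ((2 * k + 1 : ℕ) : ZMod (4 * k + 2))) := by
      rw [holeyDecode, if_pos (by omega)]
    rw [hpar]
    rcases h1 with h1 | h1 <;> rw [h1]
    · rcases h01 with h0 | h0 <;> rw [h0]
      · rw [holeyLabel, if_pos rfl, if_pos rfl, hA]
        simp [holeyCoord, h0]
      · rw [holeyLabel, if_pos rfl, if_neg one_ne_zero, hB, holeyCoord, ← hclass, hshift, h0]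
        simp [h4]
    · have hne : 2 * k + 1 ≠ 0 := by omega
      rw [natCast_two_mul_add_one]
      rcases h01 with h0 | h0 <;> rw [h0]
      · rw [holeyLabel, if_neg hne, if_pos rfl, if_pos rfl, hB, holeyCoord, ← hclass, hshift, h0]
        simp
      · rw [holeyLabel, if_neg hne, if_pos rfl, if_neg one_ne_zero, hA, holeyCoord, h0]
        simp [h4]
  · cases h
  · cases h
  · rfl

/-- For even `t`, the operation is `x ∘ y = x + g (y - x)` on a cyclic group with two additional
points. Pairs of consecutive residues have a product at infinity that depends on parity, which
removes the parity obstruction to a purely cyclic construction. -/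
theorem exists_isHoley_of_even {t : ℕ} (ht : Even t) (h4 : 4 ≤ t) :
    ∃ op : ZMod t × ZMod 2 → ZMod t × ZMod 2 → ZMod t × ZMod 2, IsHoley op := by
  obtain ⟨k, rfl⟩ : ∃ k, t = 2 * k + 2 := ⟨t / 2 - 1, by obtain ⟨r, rfl⟩ := ht; omega⟩
  have hk : 1 ≤ k := by omega
  have hbij : Function.Bijective (holeyCoord k) := by
    rw [Fintype.bijective_iff_injective_and_card]
    refine ⟨holeyCoord_injective k, ?_⟩
    simp [ZMod.card]; ring
  let f : Option (ZMod (2 * k + 1)) ≃ ZMod (2 * k + 2) :=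
    Fintype.equivOfCardEq (by simp [ZMod.card])
  refine ⟨_, IsHoley.transport ((Equiv.ofBijective _ hbij).trans (f.prodCongr (Equiv.refl _)))
    (holeyOp_comm hk) (holeyOp_inj hk) fun x y hxy => ?_⟩
  have h1 := holeyCoord_holeyOp x y (f.injective hxy)
  simp [h1]


/-! ### Shift vectors with zero sum -/

/-- Vectors of three shifts with sum zero, any two of which differ in all three coordinates. -/
structure IsShiftSet {t : ℕ} (S : Finset (ZMod 3 → ZMod t)) : Prop where
  sum_eq_zero : ∀ r ∈ S, ∀ i, r i + r (i + 1) + r (i + 2) = 0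
  injOn : ∀ i, Set.InjOn (fun r : ZMod 3 → ZMod t => r i) S

theorem IsShiftSet.mono {t : ℕ} {S S' : Finset (ZMod 3 → ZMod t)} (h : IsShiftSet S)
    (hS : S' ⊆ S) : IsShiftSet S' :=
  ⟨fun r hr => h.sum_eq_zero r (hS hr), fun i => (h.injOn i).mono (Finset.coe_subset.2 hS)⟩

/-- The vector with given first two coordinates and sum zero. -/
def shiftVector {t : ℕ} (a b : ZMod t) : ZMod 3 → ZMod t :=
  fun i => if i = 0 then a else if i = 1 then b else -(a + b)

theorem shiftVector_sum {t : ℕ} (a b : ZMod t) (i : ZMod 3) :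
    shiftVector a b i + shiftVector a b (i + 1) + shiftVector a b (i + 2) = 0 := by
  have h : i = 0 ∨ i = 1 ∨ i = 2 := by revert i; decide
  rcases h with rfl | rfl | rfl
  · change a + b + -(a + b) = 0
    ring
  · change b + -(a + b) + a = 0
    ring
  · change -(a + b) + a + b = 0
    ring

theorem isShiftSet_image {t m : ℕ} [DecidableEq (ZMod 3 → ZMod t)] (a b : Fin m → ZMod t)
    (ha : Function.Injective a) (hb : Function.Injective b)
    (hab : Function.Injective fun j => a j + b j) :
    IsShiftSet (Finset.univ.image fun j => shiftVector (a j) (b j)) ∧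
      (Finset.univ.image fun j => shiftVector (a j) (b j)).card = m := by
  have hinj : ∀ i, Function.Injective fun j => shiftVector (a j) (b j) i := by
    intro i
    have h : i = 0 ∨ i = 1 ∨ i = 2 := by revert i; decide
    rcases h with rfl | rfl | rfl
    · exact ha
    · exact hb
    · exact neg_injective.comp hab
  refine ⟨⟨?_, ?_⟩, ?_⟩
  · simp only [Finset.mem_image, Finset.mem_univ, true_and, forall_exists_index,
      forall_apply_eq_imp_iff]
    exact fun j => shiftVector_sum _ _
  · intro i r hr r' hr' h
    obtain ⟨j, -, rfl⟩ := Finset.mem_image.1 (Finset.mem_coe.1 hr)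
    obtain ⟨j', -, rfl⟩ := Finset.mem_image.1 (Finset.mem_coe.1 hr')
    rw [hinj i h]
  · rw [Finset.card_image_of_injective, Finset.card_univ, Fintype.card_fin]
    exact fun j j' h => hinj 0 (congrFun h 0)

theorem natCast_injective_of_lt {t m : ℕ} (f : Fin m → ℕ) (hf : Function.Injective f)
    (hlt : ∀ j, f j < t) : Function.Injective fun j => (f j : ZMod t) := by
  intro j j' h
  have h1 := (ZMod.natCast_eq_natCast_iff' _ _ _).1 h
  rw [Nat.mod_eq_of_lt (hlt j), Nat.mod_eq_of_lt (hlt j')] at h1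
  exact hf h1

/-- For odd `t` the vectors `(j, j, -2 j)` work. For `t = 2 u` doubling is not injective, and the
vectors `(j, j, -2 j)` with `j < u` are complemented by `(j, j + 1, -(2 j + 1))` with
`u ≤ j < t - 1`. -/
theorem exists_isShiftSet (t : ℕ) (ht : 0 < t) :
    ∃ S : Finset (ZMod 3 → ZMod t), IsShiftSet S ∧ 0 ∈ S ∧ t - 1 ≤ S.card ∧
      (Odd t → S.card = t) := by
  classical
  rcases Nat.even_or_odd t with hev | hodd
  · obtain ⟨u, rfl⟩ := hev
    let b : Fin (u + u - 1) → ℕ := fun j => if j.1 < u then j.1 else j.1 + 1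
    let s : Fin (u + u - 1) → ℕ := fun j => if j.1 < u then 2 * j.1 else 2 * j.1 + 1 - (u + u)
    obtain ⟨h1, h2⟩ := isShiftSet_image (t := u + u) (fun j : Fin (u + u - 1) => ((j : ℕ) : ZMod _))
      (fun j => (b j : ZMod _))
      (natCast_injective_of_lt _ Fin.val_injective fun j => by omega)
      (natCast_injective_of_lt _ (fun j j' h => by
        simp only [b] at h; ext; split_ifs at h <;> omega) fun j => by
        simp only [b]; split_ifs <;> omega)
      (by
        have : (fun j : Fin (u + u - 1) => ((j : ℕ) : ZMod (u + u)) + (b j : ZMod (u + u)))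
            = fun j => (s j : ZMod (u + u)) := by
          funext j
          rw [← Nat.cast_add, ZMod.natCast_eq_natCast_iff']
          simp only [b, s]
          split_ifs with h
          · rw [two_mul]
          · rw [show (j : ℕ) + (j + 1) = 2 * j + 1 - (u + u) + (u + u) by omega, Nat.add_mod_right]
        rw [this]
        refine natCast_injective_of_lt _ (fun j j' h => ?_) fun j => ?_
        · simp only [s] at h; ext; split_ifs at h <;> omega
        · simp only [s]; split_ifs <;> omega)
    refine ⟨_, h1, Finset.mem_image.2 ⟨⟨0, by omega⟩, Finset.mem_univ _, ?_⟩, h2.ge,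
      fun h => absurd h (Nat.not_odd_iff_even.2 ⟨u, rfl⟩)⟩
    funext i
    simp [b, shiftVector, show 0 < u by omega]
  · obtain ⟨u, rfl⟩ := hodd
    let s : Fin (2 * u + 1) → ℕ := fun j => if j.1 ≤ u then 2 * j.1 else 2 * j.1 - (2 * u + 1)
    obtain ⟨h1, h2⟩ := isShiftSet_image (t := 2 * u + 1)
      (fun j : Fin (2 * u + 1) => ((j : ℕ) : ZMod _)) (fun j => ((j : ℕ) : ZMod _))
      (natCast_injective_of_lt _ Fin.val_injective fun j => j.2)
      (natCast_injective_of_lt _ Fin.val_injective fun j => j.2)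
      (by
        have : (fun j : Fin (2 * u + 1) => ((j : ℕ) : ZMod (2 * u + 1)) + ((j : ℕ) : ZMod _))
            = fun j => (s j : ZMod (2 * u + 1)) := by
          funext j
          rw [← Nat.cast_add, ZMod.natCast_eq_natCast_iff']
          simp only [s]
          split_ifs with h
          · rw [← two_mul]
          · rw [show (j : ℕ) + j = 2 * j - (2 * u + 1) + (2 * u + 1) by omega, Nat.add_mod_right]
        rw [this]
        refine natCast_injective_of_lt _ (fun j j' h => ?_) fun j => ?_
        · simp only [s] at h; ext; split_ifs at h <;> omega
        · simp only [s]; split_ifs <;> omega)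
    refine ⟨_, h1, Finset.mem_image.2 ⟨⟨0, by omega⟩, Finset.mem_univ _, ?_⟩, by omega,
      fun _ => h2⟩
    funext i
    simp [shiftVector]


/-! ### Triple systems on three columns -/

/-- The points: three columns, each the union of `t` holes of size two. -/
abbrev ColumnPoint (t : ℕ) := (ZMod t × ZMod 2) × ZMod 3

section Columns

variable {Q : Type*}

/-- The triples with `p` and `q` in one column and `z` in another one. The relation `P` describes
those with `z` in the next column, `M` those with `z` in the previous column. -/
def ApexRel (P M : ZMod 3 → Q → Q → Q → Prop) (p q z : Q × ZMod 3) : Prop :=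
  p.2 = q.2 ∧ ((z.2 = p.2 + 1 ∧ P p.2 p.1 q.1 z.1) ∨ (z.2 = p.2 + 2 ∧ M p.2 p.1 q.1 z.1))

/-- The triples that meet every column; `R` describes the transversals of the columns. -/
def TransversalRel (R : (ZMod 3 → Q) → Prop) (p q z : Q × ZMod 3) : Prop :=
  p.2 ≠ q.2 ∧ p.2 ≠ z.2 ∧ q.2 ≠ z.2 ∧ ∃ u, R u ∧ u p.2 = p.1 ∧ u q.2 = q.1 ∧ u z.2 = z.1

/-- The triple system without triples inside a column that is described by `P`, `M` and `R`. -/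
def ColumnRel (P M : ZMod 3 → Q → Q → Q → Prop) (R : (ZMod 3 → Q) → Prop)
    (p q z : Q × ZMod 3) : Prop :=
  ApexRel P M p q z ∨ ApexRel P M q z p ∨ ApexRel P M z p q ∨ TransversalRel R p q z

theorem ApexRel.symm {P M : ZMod 3 → Q → Q → Q → Prop} (hP : ∀ i x y w, P i x y w → P i y x w)
    (hM : ∀ i x y w, M i x y w → M i y x w) {p q z : Q × ZMod 3} (h : ApexRel P M p q z) :
    ApexRel P M q p z := by
  obtain ⟨h1, h2⟩ := h
  refine ⟨h1.symm, ?_⟩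
  rw [← h1]
  exact h2.imp (fun h => ⟨h.1, hP _ _ _ _ h.2⟩) fun h => ⟨h.1, hM _ _ _ _ h.2⟩

theorem isSymmetricTernary_columnRel {P M : ZMod 3 → Q → Q → Q → Prop} {R : (ZMod 3 → Q) → Prop}
    (hP : ∀ i x y w, P i x y w → P i y x w) (hM : ∀ i x y w, M i x y w → M i y x w) :
    IsSymmetricTernary (ColumnRel P M R) where
  swap_left := by
    rintro p q z (h | h | h | ⟨h1, h2, h3, u, h4, h5, h6, h7⟩)
    · exact .inl (h.symm hP hM)
    · exact .inr (.inr (.inl (h.symm hP hM)))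
    · exact .inr (.inl (h.symm hP hM))
    · exact .inr (.inr (.inr ⟨h1.symm, h3, h2, u, h4, h6, h5, h7⟩))
  swap_right := by
    rintro p q z (h | h | h | ⟨h1, h2, h3, u, h4, h5, h6, h7⟩)
    · exact .inr (.inr (.inl (h.symm hP hM)))
    · exact .inr (.inl (h.symm hP hM))
    · exact .inl (h.symm hP hM)
    · exact .inr (.inr (.inr ⟨h2, h1, h3.symm, u, h4, h5, h7, h6⟩))

theorem ncard_eq_sum_columns [Finite Q] (A : Set (Q × ZMod 3)) (i : ZMod 3) :
    A.ncard = {w | (w, i) ∈ A}.ncard + {w | (w, i + 1) ∈ A}.ncard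
      + {w | (w, i + 2) ∈ A}.ncard := by
  have hinj : ∀ j : ZMod 3, Function.Injective fun w : Q => (w, j) :=
    fun j w w' h => (Prod.ext_iff.1 h).1
  have hne : i ≠ i + 1 ∧ i ≠ i + 2 ∧ i + 1 ≠ i + 2 := by revert i; decide
  have hall : ∀ j, j = i ∨ j = i + 1 ∨ j = i + 2 := by revert i; decide
  rw [← Set.ncard_image_of_injective {w | (w, i) ∈ A} (hinj i),
    ← Set.ncard_image_of_injective {w | (w, i + 1) ∈ A} (hinj (i + 1)),
    ← Set.ncard_image_of_injective {w | (w, i + 2) ∈ A} (hinj (i + 2)),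
    ← Set.ncard_union_eq, ← Set.ncard_union_eq]
  · congr 1
    ext ⟨w, j⟩
    simp only [Set.mem_union, Set.mem_image, Prod.mk.injEq]
    constructor
    · intro h
      rcases hall j with rfl | rfl | rfl
      · exact .inl (.inl ⟨w, h, rfl, rfl⟩)
      · exact .inl (.inr ⟨w, h, rfl, rfl⟩)
      · exact .inr ⟨w, h, rfl, rfl⟩
    · rintro ((⟨w', h, rfl, rfl⟩ | ⟨w', h, rfl, rfl⟩) | ⟨w', h, rfl, rfl⟩) <;> exact h
  · rw [Set.disjoint_left]
    rintro _ (⟨w, -, rfl⟩ | ⟨w, -, rfl⟩) ⟨w', -, h⟩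
    · exact hne.2.1 (Prod.ext_iff.1 h).2.symm
    · exact hne.2.2 (Prod.ext_iff.1 h).2.symm
  · rw [Set.disjoint_left]
    rintro _ ⟨w, -, rfl⟩ ⟨w', -, h⟩
    exact hne.1 (Prod.ext_iff.1 h).2.symm

theorem pairDegree_columnRel_same [Finite Q] {P M : ZMod 3 → Q → Q → Q → Prop}
    {R : (ZMod 3 → Q) → Prop} (x y : Q) (i : ZMod 3) :
    pairDegree (ColumnRel P M R) (x, i) (y, i)
      = {w | P i x y w}.ncard + {w | M i x y w}.ncard := by
  have hne : i ≠ i + 1 ∧ i ≠ i + 2 ∧ i + 1 ≠ i + 2 := by revert i; decide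
  rw [pairDegree, ncard_eq_sum_columns _ i]
  have h0 : {w | (w, i) ∈ {z | z ≠ (x, i) ∧ z ≠ (y, i) ∧ ColumnRel P M R (x, i) (y, i) z}} = ∅ := by
    ext w
    simp [ColumnRel, ApexRel, TransversalRel, hne.1, hne.2.1]
  rw [h0, Set.ncard_empty, zero_add]
  congr 2
  · ext w
    simp [ColumnRel, ApexRel, TransversalRel, hne.1, hne.1.symm, hne.2.2]
  · ext w
    simp [ColumnRel, ApexRel, TransversalRel, hne.2.1, hne.2.1.symm, hne.2.2.symm]

theorem pairDegree_columnRel_succ [Finite Q] {P M : ZMod 3 → Q → Q → Q → Prop}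
    {R : (ZMod 3 → Q) → Prop} (x y : Q) (i : ZMod 3) :
    pairDegree (ColumnRel P M R) (x, i) (y, i + 1)
      = {w | w ≠ x ∧ P i w x y}.ncard + {w | w ≠ y ∧ M (i + 1) y w x}.ncard
        + {w | ∃ u, R u ∧ u i = x ∧ u (i + 1) = y ∧ u (i + 2) = w}.ncard := by
  have hne : i ≠ i + 1 ∧ i ≠ i + 2 ∧ i + 1 ≠ i + 2 := by revert i; decide
  have h1 : i + 1 + 1 = i + 2 := by revert i; decide
  have h2 : i + 1 + 2 = i := by revert i; decide
  rw [pairDegree, ncard_eq_sum_columns _ i]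
  congr 2
  · congr 1
    ext w
    simp [ColumnRel, ApexRel, TransversalRel, hne.1, hne.1.symm, hne.2.2]
  · congr 1
    ext w
    simp [ColumnRel, ApexRel, TransversalRel, hne.1, hne.1.symm, hne.2.1, h1, h2]
  · ext w
    simp [ColumnRel, ApexRel, TransversalRel, hne.1, hne.2.1, hne.2.1.symm, hne.2.2, hne.2.2.symm]

end Columns

/-! ### Combining one base system with twofold designs -/

section Counting

variable {t : ℕ}

theorem ncard_fst_mem_image {ι : Type*} (S : Finset ι) (f : ι → ZMod t) (hf : Set.InjOn f S) :
    {w : ZMod t × ZMod 2 | ∃ r ∈ S, w.1 = f r}.ncard = 2 * S.card := by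
  classical
  have h : {w : ZMod t × ZMod 2 | ∃ r ∈ S, w.1 = f r}
      = ((S.image f) ×ˢ (Finset.univ : Finset (ZMod 2)) : Finset (ZMod t × ZMod 2)) := by
    ext w
    simp [eq_comm]
  rw [h, Set.ncard_coe_finset, Finset.card_product, Finset.card_image_of_injOn hf]
  simp [ZMod.card, mul_comm]

/-- The left translate by `x` turns the count of `w` into a count of products; the element `w = x`
is the one exception. -/
theorem ncard_ne_op_add [NeZero t] {op : ZMod t × ZMod 2 → ZMod t × ZMod 2 → ZMod t × ZMod 2}
    (hop : IsHoley op) {ι : Type*} (S : Finset ι) (f : ι → ZMod t) (hf : Set.InjOn f S)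
    (x : ZMod t × ZMod 2) [Decidable (∃ r ∈ S, x.1 = f r)] :
    {w | w ≠ x ∧ ∃ r ∈ S, (op x w).1 = f r}.ncard + (if ∃ r ∈ S, x.1 = f r then 1 else 0)
      = 2 * S.card := by
  have hbij : Function.Bijective (op x) := Finite.injective_iff_bijective.1 (hop.inj x)
  have hx : (op x x).1 = x.1 := by rw [hop.hole x.1 x.2 x.2]
  rw [← ncard_fst_mem_image S f hf]
  have h1 : {w : ZMod t × ZMod 2 | ∃ r ∈ S, w.1 = f r}.ncard
      = {w | ∃ r ∈ S, (op x w).1 = f r}.ncard := by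
    rw [← Set.ncard_image_of_injective {w | ∃ r ∈ S, (op x w).1 = f r} hbij.1]
    congr 1
    ext w
    obtain ⟨w, rfl⟩ := hbij.2 w
    simp [hbij.1.eq_iff]
  rw [h1]
  split_ifs with h
  · have h2 : {w | ∃ r ∈ S, (op x w).1 = f r}
        = insert x {w | w ≠ x ∧ ∃ r ∈ S, (op x w).1 = f r} := by
      ext w
      by_cases hw : w = x
      · subst hw; simp [hx, h]
      · simp [hw]
    rw [h2, Set.ncard_insert_of_notMem (by simp)]
  · rw [add_zero]
    congr 1
    ext w
    by_cases hw : w = x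
    · subst hw; simpa [hx] using h
    · simp [hw]

/-- Transversals whose shifts between consecutive columns form a vector in `S`, with prescribed sum
of the positions in the holes. -/
def ShiftRel (S : Finset (ZMod 3 → ZMod t)) (e : ZMod 2) (u : ZMod 3 → ZMod t × ZMod 2) : Prop :=
  (∃ r ∈ S, ∀ i, (u (i + 1)).1 = (u i).1 + r i) ∧ (u 0).2 + (u 1).2 + (u 2).2 = e

theorem shiftRel_iff {S : Finset (ZMod 3 → ZMod t)} (hS : IsShiftSet S) {e : ZMod 2}
    {u : ZMod 3 → ZMod t × ZMod 2} (i : ZMod 3) :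
    ShiftRel S e u ↔ ∃ r ∈ S, (u (i + 1)).1 = (u i).1 + r i ∧
      u (i + 2) = ((u (i + 1)).1 + r (i + 1), e - (u i).2 - (u (i + 1)).2) := by
  have h1 : ∀ i : ZMod 3, i + 1 + 1 = i + 2 := by decide
  have h2 : ∀ i : ZMod 3, i + 2 + 1 = i := by decide
  have hall : ∀ i j : ZMod 3, j = i ∨ j = i + 1 ∨ j = i + 2 := by decide
  have hsum : (u 0).2 + (u 1).2 + (u 2).2 = (u i).2 + (u (i + 1)).2 + (u (i + 2)).2 := by
    have h : i = 0 ∨ i = 1 ∨ i = 2 := by revert i; decide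
    rcases h with rfl | rfl | rfl
    · rfl
    · change _ = (u 1).2 + (u 2).2 + (u 0).2
      ring
    · change _ = (u 2).2 + (u 0).2 + (u 1).2
      ring
  rw [ShiftRel, hsum]
  constructor
  · rintro ⟨⟨r, hr, h⟩, he⟩
    refine ⟨r, hr, h i, Prod.ext ?_ ?_⟩
    · rw [← h (i + 1), h1]
    · rw [← he]; ring
  · rintro ⟨r, hr, h, h'⟩
    have h3 := hS.sum_eq_zero r hr i
    refine ⟨⟨r, hr, fun j => ?_⟩, ?_⟩
    · rcases hall i j with rfl | rfl | rfl
      · exact h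
      · rw [h1, h']
      · rw [h2, h', h]
        linear_combination -h3
    · rw [h']; ring

theorem ncard_shiftRel {S : Finset (ZMod 3 → ZMod t)} (hS : IsShiftSet S) (e : ZMod 2)
    (x y : ZMod t × ZMod 2) (i : ZMod 3) [Decidable (∃ r ∈ S, y.1 = x.1 + r i)] :
    {w | ∃ u, ShiftRel S e u ∧ u i = x ∧ u (i + 1) = y ∧ u (i + 2) = w}.ncard
      = if ∃ r ∈ S, y.1 = x.1 + r i then 1 else 0 := by
  have hne : ∀ i : ZMod 3, i ≠ i + 1 ∧ i ≠ i + 2 ∧ i + 1 ≠ i + 2 := by decide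
  replace hne := hne i
  split_ifs with h
  · obtain ⟨r, hr, h⟩ := h
    rw [Set.ncard_eq_one]
    refine ⟨(y.1 + r (i + 1), e - x.2 - y.2), ?_⟩
    ext w
    rw [Set.mem_singleton_iff]
    constructor
    · rintro ⟨u, hu, rfl, rfl, rfl⟩
      obtain ⟨r', hr', h', hu⟩ := (shiftRel_iff hS i).1 hu
      have : r' = r := hS.injOn i hr' hr (add_left_cancel (h'.symm.trans h))
      rw [hu, this]
    · rintro rfl
      refine ⟨fun j => if j = i then x else if j = i + 1 then y
        else (y.1 + r (i + 1), e - x.2 - y.2), (shiftRel_iff hS i).2 ⟨r, hr, ?_, ?_⟩,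
        ?_, ?_, ?_⟩ <;>
        simp [hne.1.symm, hne.2.1.symm, hne.2.2.symm, h]
  · refine (congrArg Set.ncard (?_ : _ = ∅)).trans (Set.ncard_empty _)
    ext w
    simp only [Set.mem_empty_iff_false, iff_false]
    rintro ⟨u, hu, rfl, rfl, rfl⟩
    obtain ⟨r, hr, h', -⟩ := (shiftRel_iff hS i).1 hu
    exact h ⟨r, hr, h'⟩

/-- The deviation of the pair degrees of a base system: `1` on the holes over `K` in each column,
`-1` on the remaining holes, `0` elsewhere. -/
def holeDefect (K : Finset (ZMod t)) (p q : ColumnPoint t) : ℤ :=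
  if p.1.1 = q.1.1 ∧ p.2 = q.2 then (if p.1.1 ∈ K then 1 else -1) else 0

/-- The blocks `{(x, i), (y, i), (w, i + 1)}`: those of the twofold designs with shifts in `S`,
those of the base system that meet several holes, and those that fill the holes over `K`. -/
def nextRel (op : ZMod t × ZMod 2 → ZMod t × ZMod 2 → ZMod t × ZMod 2) (K : Finset (ZMod t))
    (S : Finset (ZMod 3 → ZMod t)) (i : ZMod 3) (x y w : ZMod t × ZMod 2) : Prop :=
  (∃ r ∈ S, w.1 = (op x y).1 + r i) ∨ (x.1 ≠ y.1 ∧ w = op x y) ∨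
    (x.1 = y.1 ∧ w.1 = x.1 ∧ x.1 ∈ K)

/-- The blocks `{(x, i), (y, i), (w, i - 1)}`, which belong to the twofold designs with shifts in
`S`. -/
def prevRel (op : ZMod t × ZMod 2 → ZMod t × ZMod 2 → ZMod t × ZMod 2)
    (S : Finset (ZMod 3 → ZMod t)) (i : ZMod 3) (x y w : ZMod t × ZMod 2) : Prop :=
  ∃ r ∈ S, (op x y).1 = w.1 + r (i + 2)

/-- The transversal blocks: those of the twofold designs of both orientations, and those that fill
the holes outside `K`. -/
def baseTransversalRel (K : Finset (ZMod t)) (S S' : Finset (ZMod 3 → ZMod t))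
    (u : ZMod 3 → ZMod t × ZMod 2) : Prop :=
  ShiftRel S 0 u ∨ ShiftRel S' 1 u ∨ (ShiftRel {0} 0 u ∧ (u 0).1 ∉ K)

theorem isShiftSet_singleton_zero : IsShiftSet ({0} : Finset (ZMod 3 → ZMod t)) :=
  ⟨by simp, by simp⟩

theorem ncard_prevRel {op : ZMod t × ZMod 2 → ZMod t × ZMod 2 → ZMod t × ZMod 2}
    {S : Finset (ZMod 3 → ZMod t)} (hS : IsShiftSet S) (i : ZMod 3)
    (x y : ZMod t × ZMod 2) :
    {w | prevRel op S i x y w}.ncard = 2 * S.card := by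
  rw [← ncard_fst_mem_image S (fun r => (op x y).1 - r (i + 2))
    fun r hr r' hr' h => hS.injOn (i + 2) hr hr' (sub_right_injective h)]
  congr 1
  ext w
  simp only [prevRel, Set.mem_ofPred_eq, eq_sub_iff_add_eq, eq_comm]

variable [NeZero t] {op : ZMod t × ZMod 2 → ZMod t × ZMod 2 → ZMod t × ZMod 2}

theorem ncard_nextRel (hop : IsHoley op) {K : Finset (ZMod t)} {S : Finset (ZMod 3 → ZMod t)}
    (hS : IsShiftSet S) (h0 : ∀ r ∈ S, ∀ i, r i ≠ 0) (i : ZMod 3) (x y : ZMod t × ZMod 2) :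
    ({w | nextRel op K S i x y w}.ncard : ℤ)
      = 2 * S.card + 1 + holeDefect K (x, i) (y, i) := by
  have h1 : {w | nextRel op K S i x y w} = {w | ∃ r ∈ S, w.1 = (op x y).1 + r i} ∪
      {w | (x.1 ≠ y.1 ∧ w = op x y) ∨ (x.1 = y.1 ∧ w.1 = x.1 ∧ x.1 ∈ K)} := rfl
  have hin : x.1 = y.1 → (op x y).1 = x.1 := fun h => by
    have := hop.hole x.1 x.2 y.2
    rw [show (x.1, y.2) = y from Prod.ext h rfl] at this
    rw [show op x y = _ from this]
  rw [h1, Set.ncard_union_eq, ncard_fst_mem_image S (fun r => (op x y).1 + r i)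
    fun r hr r' hr' h => hS.injOn i hr hr' (add_left_cancel h)]
  · have h2 : ({w : ZMod t × ZMod 2 | (x.1 ≠ y.1 ∧ w = op x y) ∨
        (x.1 = y.1 ∧ w.1 = x.1 ∧ x.1 ∈ K)}.ncard : ℤ) = 1 + holeDefect K (x, i) (y, i) := by
      by_cases h : x.1 = y.1
      · by_cases hK : x.1 ∈ K
        · have := ncard_fst_mem_image (t := t) {()} (fun _ => x.1) (by simp)
          simp only [Finset.mem_singleton, Finset.card_singleton, exists_const, true_and] at this
          simp only [h, holeDefect] at this hK ⊢
          simp [hK, this]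
        · simp only [h, holeDefect] at hK ⊢
          simp [hK]
      · simp [h, holeDefect]
    push_cast
    rw [h2]; ring
  · rw [Set.disjoint_left]
    rintro w ⟨r, hr, hw⟩ (⟨-, rfl⟩ | ⟨h2, h3, -⟩)
    · exact h0 r hr i (left_eq_add.1 hw)
    · rw [hin h2, h3] at hw
      exact h0 r hr i (left_eq_add.1 hw)

open Classical in
theorem ncard_nextRel_apex (hop : IsHoley op) {K : Finset (ZMod t)}
    {S : Finset (ZMod 3 → ZMod t)} (hS : IsShiftSet S) (h0 : ∀ r ∈ S, ∀ i, r i ≠ 0) (i : ZMod 3)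
    (x y : ZMod t × ZMod 2) :
    {w | w ≠ x ∧ nextRel op K S i w x y}.ncard + (if ∃ r ∈ S, y.1 = x.1 + r i then 1 else 0)
        + (if x.1 = y.1 ∧ x.1 ∉ K then 1 else 0) = 2 * S.card + 1 := by
  have hbij : Function.Bijective (op x) := Finite.injective_iff_bijective.1 (hop.inj x)
  have hin : ∀ w, w.1 = x.1 → op x w = (x.1, x.2 + w.2) := fun w h => by
    have := hop.hole x.1 x.2 w.2
    rwa [show (x.1, w.2) = w from Prod.ext h.symm rfl] at this
  have h1 : {w | w ≠ x ∧ nextRel op K S i w x y}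
      = {w | w ≠ x ∧ ∃ r ∈ S, (op x w).1 = y.1 - r i} ∪
        {w | (w.1 ≠ x.1 ∧ y = op x w) ∨ (w ≠ x ∧ w.1 = x.1 ∧ y.1 = x.1 ∧ x.1 ∈ K)} := by
    ext w
    simp only [nextRel, Set.mem_ofPred_eq, Set.mem_union, eq_sub_iff_add_eq, hop.comm w x]
    constructor
    · rintro ⟨h, ⟨r, hr, h2⟩ | h2 | ⟨h2, h3, h4⟩⟩
      · exact .inl ⟨h, r, hr, h2.symm⟩
      · exact .inr (.inl h2)
      · exact .inr (.inr ⟨h, h2, h3.trans h2, h2 ▸ h4⟩)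
    · rintro (⟨h, r, hr, h2⟩ | h2 | ⟨h, h2, h3, h4⟩)
      · exact ⟨h, .inl ⟨r, hr, h2.symm⟩⟩
      · exact ⟨fun h => h2.1 (h ▸ rfl), .inr (.inl h2)⟩
      · exact ⟨h, .inr (.inr ⟨h2, h3.trans h2.symm, h2.symm ▸ h4⟩)⟩
  have h2 := ncard_ne_op_add hop S (fun r => y.1 - r i)
    (fun r hr r' hr' h => hS.injOn i hr hr' (sub_right_injective h)) x
  have h3 : (∃ r ∈ S, x.1 = y.1 - r i) ↔ ∃ r ∈ S, y.1 = x.1 + r i := by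
    simp only [eq_sub_iff_add_eq, eq_comm]
  simp only [h3] at h2
  -- Exactly one `w` completes `x` and `y` to a block of the base system with apex `y`, unless `x`
  -- and `y` have the same hole coordinate.
  have h4 : {w : ZMod t × ZMod 2 | (w.1 ≠ x.1 ∧ y = op x w) ∨
      (w ≠ x ∧ w.1 = x.1 ∧ y.1 = x.1 ∧ x.1 ∈ K)}.ncard
        + (if x.1 = y.1 ∧ x.1 ∉ K then 1 else 0) = 1 := by
    by_cases hy : y.1 = x.1
    · have h5 : ∀ w, ¬ (w.1 ≠ x.1 ∧ y = op x w) := by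
        rintro w ⟨hw, h⟩
        have h6 := hin (x.1, y.2 - x.2) rfl
        rw [add_sub_cancel] at h6
        have h7 : op x (x.1, y.2 - x.2) = op x w := by
          rw [h6, ← h]; exact Prod.ext hy.symm rfl
        exact hw (by rw [← hbij.1 h7])
      by_cases hK : x.1 ∈ K
      · have h6 : {w : ZMod t × ZMod 2 | (w.1 ≠ x.1 ∧ y = op x w) ∨
            (w ≠ x ∧ w.1 = x.1 ∧ y.1 = x.1 ∧ x.1 ∈ K)} = {(x.1, x.2 + 1)} := by
          ext w
          simp only [Set.mem_ofPred_eq, h5, false_or, Set.mem_singleton_iff, hy, hK, and_true]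
          have hbit : ∀ a b : ZMod 2, a ≠ b ↔ a = b + 1 := by decide
          rw [Ne, Prod.ext_iff, Prod.ext_iff, ← hbit]
          tauto
        rw [h6, Set.ncard_singleton]
        simp [hK]
      · simp [h5, hK, hy]
    · obtain ⟨w, rfl⟩ := hbij.2 y
      have hw : w.1 ≠ x.1 := fun h => hy (by rw [hin w h])
      have h6 : {w' : ZMod t × ZMod 2 | (w'.1 ≠ x.1 ∧ op x w = op x w') ∨
            (w' ≠ x ∧ w'.1 = x.1 ∧ (op x w).1 = x.1 ∧ x.1 ∈ K)} = {w} := by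
        ext w'
        simp only [Set.mem_ofPred_eq, hy, false_and, and_false, or_false, Set.mem_singleton_iff,
          hbij.1.eq_iff]
        exact ⟨fun h => h.2.symm, fun h => ⟨h ▸ hw, h.symm⟩⟩
      rw [h6, Set.ncard_singleton, if_neg fun h => hy h.1.symm]
  rw [h1, Set.ncard_union_eq]
  · omega
  · rw [Set.disjoint_left]
    rintro w ⟨-, r, hr, hw⟩ (⟨-, rfl⟩ | ⟨-, h5, h6, -⟩)
    · exact h0 r hr i (by rwa [eq_comm, sub_eq_self] at hw)
    · rw [hin w h5, h6] at hw
      exact h0 r hr i (by rwa [eq_comm, sub_eq_self] at hw)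

open Classical in
theorem ncard_prevRel_apex (hop : IsHoley op) {S : Finset (ZMod 3 → ZMod t)} (hS : IsShiftSet S)
    (i : ZMod 3) (x y : ZMod t × ZMod 2) :
    {w | w ≠ y ∧ prevRel op S (i + 1) y w x}.ncard
      + (if ∃ r ∈ S, y.1 = x.1 + r i then 1 else 0) = 2 * S.card := by
  have h : i + 1 + 2 = i := by revert i; decide
  rw [← ncard_ne_op_add hop S (fun r => x.1 + r i)
    (fun r hr r' hr' h => hS.injOn i hr hr' (add_left_cancel h)) y]
  simp only [prevRel, h]

open Classical in
theorem ncard_baseTransversalRel {K : Finset (ZMod t)} {S S' : Finset (ZMod 3 → ZMod t)}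
    (hS : IsShiftSet S) (h0 : ∀ r ∈ S, ∀ i, r i ≠ 0) (hS' : IsShiftSet S')
    (x y : ZMod t × ZMod 2) (i : ZMod 3) :
    {w | ∃ u, baseTransversalRel K S S' u ∧ u i = x ∧ u (i + 1) = y ∧ u (i + 2) = w}.ncard
      = (if ∃ r ∈ S, y.1 = x.1 + r i then 1 else 0) + (if ∃ r ∈ S', y.1 = x.1 + r i then 1 else 0)
        + (if x.1 = y.1 ∧ x.1 ∉ K then 1 else 0) := by
  have hconst : ∀ u : ZMod 3 → ZMod t × ZMod 2, ShiftRel {0} 0 u → (u 0).1 = (u i).1 := by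
    rintro u ⟨⟨r, hr, h⟩, -⟩
    rw [Finset.mem_singleton] at hr
    subst hr
    have hi : i = 0 ∨ i = 1 ∨ i = 2 := by revert i; decide
    have h1 := h 0
    have h2 := h 1
    rcases hi with rfl | rfl | rfl
    · rfl
    · simpa using h1.symm
    · exact ((h2.trans (add_zero _)).trans (h1.trans (add_zero _))).symm
  have hu : {w | ∃ u, baseTransversalRel K S S' u ∧ u i = x ∧ u (i + 1) = y ∧ u (i + 2) = w}
      = ({w | ∃ u, ShiftRel S 0 u ∧ u i = x ∧ u (i + 1) = y ∧ u (i + 2) = w} ∪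
        {w | ∃ u, ShiftRel S' 1 u ∧ u i = x ∧ u (i + 1) = y ∧ u (i + 2) = w}) ∪
        {w | x.1 ∉ K ∧ ∃ u, ShiftRel {0} 0 u ∧ u i = x ∧ u (i + 1) = y ∧ u (i + 2) = w} := by
    ext w
    constructor
    · rintro ⟨u, h | h | ⟨h, h1⟩, hx, hy, hw⟩
      · exact .inl (.inl ⟨u, h, hx, hy, hw⟩)
      · exact .inl (.inr ⟨u, h, hx, hy, hw⟩)
      · exact .inr ⟨by rwa [← hx, ← hconst u h], u, h, hx, hy, hw⟩
    · rintro ((⟨u, h, hx, hy, hw⟩ | ⟨u, h, hx, hy, hw⟩) | ⟨hK, u, h, hx, hy, hw⟩)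
      · exact ⟨u, .inl h, hx, hy, hw⟩
      · exact ⟨u, .inr (.inl h), hx, hy, hw⟩
      · exact ⟨u, .inr (.inr ⟨h, by rwa [hconst u h, hx]⟩), hx, hy, hw⟩
  have hbit : ∀ {S S' : Finset (ZMod 3 → ZMod t)}, IsShiftSet S → IsShiftSet S' →
      ∀ {w e e'}, (∃ u, ShiftRel S e u ∧ u i = x ∧ u (i + 1) = y ∧ u (i + 2) = w) →
      (∃ u, ShiftRel S' e' u ∧ u i = x ∧ u (i + 1) = y ∧ u (i + 2) = w) →
      e = e' ∧ ∃ r ∈ S, ∃ r' ∈ S', y.1 = x.1 + r i ∧ y.1 = x.1 + r' i := by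
    rintro S S' hS hS' w e e' ⟨u, h, hx, hy, hw⟩ ⟨u', h', hx', hy', hw'⟩
    obtain ⟨r, hr, h1, h2⟩ := (shiftRel_iff hS i).1 h
    obtain ⟨r', hr', h1', h2'⟩ := (shiftRel_iff hS' i).1 h'
    rw [hx, hy] at h1 h2
    rw [hx', hy'] at h1' h2'
    rw [hw] at h2
    rw [hw', h2] at h2'
    exact ⟨by simpa using (Prod.ext_iff.1 h2').2, r, hr, r', hr', h1, h1'⟩
  rw [hu, Set.ncard_union_eq, Set.ncard_union_eq, ncard_shiftRel hS, ncard_shiftRel hS']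
  · congr 1
    by_cases hK : x.1 ∈ K
    · simp [hK]
    · have h1 := ncard_shiftRel isShiftSet_singleton_zero 0 x y i
      simp only [Finset.mem_singleton, exists_eq_left, Pi.zero_apply, add_zero] at h1
      simp only [hK, not_false_eq_true, true_and, and_true, h1]
      simp only [eq_comm]
  · rw [Set.disjoint_left]
    intro w h h'
    exact zero_ne_one (hbit hS hS' h h').1
  · rw [Set.disjoint_left]
    rintro w (h | h) ⟨-, h'⟩
    · obtain ⟨-, r, hr, r', hr', h1, h2⟩ := hbit hS isShiftSet_singleton_zero h h'
      rw [Finset.mem_singleton.1 hr', h1] at h2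
      exact h0 r hr i (add_left_cancel h2)
    · exact one_ne_zero (hbit hS' isShiftSet_singleton_zero h h').1

/-- A triple system without repeated blocks whose pair degrees are `lam`, corrected by
`holeDefect K`. -/
def IsBase (K : Finset (ZMod t)) (lam : ℤ)
    (T : ColumnPoint t → ColumnPoint t → ColumnPoint t → Prop) :
    Prop :=
  IsSymmetricTernary T ∧ ∀ p q, p ≠ q → (pairDegree T p q : ℤ) = lam + holeDefect K p q

/-- The block `{(a, 0), (a, 1)}` of the first column with the point `(a, 0)` of the second column,
whose addition turns a hole outside `K` into a star. -/
def IsStarBlock (T : ColumnPoint t → ColumnPoint t → ColumnPoint t → Prop) (a : ZMod t) : Prop :=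
  T ((a, 0), 0) ((a, 1), 0) ((a, 0), 1)

/-- Inside a column, the blocks of a twofold design cover every pair twice. Between consecutive
columns `i` and `i + 1`, the pairs `(x, i)`, `(y, i + 1)` with hole coordinates differing by the
shift `r i` lose one block, as `w = x` gives no block, and regain it as a transversal. The base
system covers every pair of points in different holes once. -/
theorem exists_isBase_of_isShiftSet (hop : IsHoley op) (K : Finset (ZMod t))
    {S S' : Finset (ZMod 3 → ZMod t)} (hS : IsShiftSet S) (h0 : ∀ r ∈ S, ∀ i, r i ≠ 0)
    (hS' : IsShiftSet S') :
    ∃ T, IsBase K (2 * (S.card + S'.card) + 1) T ∧ ∀ a ∉ K, ¬ IsStarBlock T a := by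
  classical
  let T := ColumnRel (nextRel op K S) (prevRel op S') (baseTransversalRel K S S')
  have hT : IsSymmetricTernary T := by
    refine isSymmetricTernary_columnRel ?_ ?_
    · rintro i x y w (h | ⟨h1, h2⟩ | ⟨h1, h2, h3⟩)
      · exact .inl (by rwa [hop.comm y x])
      · exact .inr (.inl ⟨h1.symm, by rwa [hop.comm y x]⟩)
      · exact .inr (.inr ⟨h1.symm, h2.trans h1, h1 ▸ h3⟩)
    · intro i x y w h
      unfold prevRel at h ⊢
      rwa [hop.comm y x]
  have hsucc : ∀ x y i, (pairDegree T (x, i) (y, i + 1) : ℤ) = 2 * (S.card + S'.card) + 1 := by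
    intro x y i
    have h1 := pairDegree_columnRel_succ (P := nextRel op K S) (M := prevRel op S')
      (R := baseTransversalRel K S S') x y i
    have h2 := ncard_nextRel_apex hop (K := K) hS h0 i x y
    have h3 := ncard_prevRel_apex hop hS' i x y
    have h4 := ncard_baseTransversalRel (K := K) hS h0 hS' x y i
    change pairDegree T (x, i) (y, i + 1) = _ at h1
    omega
  have hne : ∀ i : ZMod 3, i ≠ i + 1 := by decide
  refine ⟨T, ⟨hT, ?_⟩, ?_⟩
  · rintro ⟨x, i⟩ ⟨y, j⟩ hpq
    have hj : j = i ∨ j = i + 1 ∨ i = j + 1 := by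
      clear hpq; revert i j; decide
    rcases hj with rfl | rfl | rfl
    · have h1 := pairDegree_columnRel_same (P := nextRel op K S) (M := prevRel op S')
        (R := baseTransversalRel K S S') x y j
      change pairDegree T (x, j) (y, j) = _ at h1
      rw [h1, Nat.cast_add, ncard_nextRel hop hS h0 j, ncard_prevRel hS']
      push_cast
      ring
    · rw [hsucc]; simp [holeDefect, hne]
    · rw [pairDegree_comm hT, hsucc]; simp [holeDefect, (hne _).symm]
  · intro a ha h
    have hop' : op (a, 0) (a, 1) = (a, 1) := by simpa using hop.hole a 0 1
    rcases h with ⟨-, ⟨-, h⟩ | ⟨h, -⟩⟩ | ⟨h, -⟩ | ⟨h, -⟩ | ⟨h, -⟩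
    · rcases h with ⟨r, hr, h⟩ | ⟨h, -⟩ | ⟨-, -, h⟩
      · rw [hop'] at h
        exact h0 r hr 0 (left_eq_add.1 h)
      · exact h rfl
      · exact ha h
    · exact absurd (show (1 : ZMod 3) = 0 + 2 from h) (by decide)
    · exact absurd (show (0 : ZMod 3) = 1 from h) (by decide)
    · exact absurd (show (1 : ZMod 3) = 0 from h) (by decide)
    · exact h rfl

end Counting


/-! ### Defects of matchings and stars -/

theorem defect_matchingGraph (p q : ℕ) (x y : (Fin p ⊕ Fin q) × Bool) :
    (matchingGraph p q).defect x y
      = if x.1 = y.1 ∧ x.2 ≠ y.2 then Sum.elim (fun _ => 1) (fun _ => -1) x.1 else 0 := by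
  obtain ⟨s | s, c⟩ := x <;> obtain ⟨s', c'⟩ := y
  · simp [TwoColoredGraph.defect, matchingGraph]
  · simp [TwoColoredGraph.defect, matchingGraph, neg_ite]

theorem defect_disjUnion {W W' : Type*} (H : TwoColoredGraph W) (H' : TwoColoredGraph W')
    (x y : W ⊕ W') :
    (H.disjUnion H').defect x y
      = Sum.elim (fun a => Sum.elim (fun b => H.defect a b) (fun _ => 0) y)
        (fun a => Sum.elim (fun _ => 0) (fun b => H'.defect a b) y) x := by
  rcases x with x | x <;> rcases y with y | y
  · rfl
  · simp [TwoColoredGraph.defect, TwoColoredGraph.disjUnion]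
  · simp [TwoColoredGraph.defect, TwoColoredGraph.disjUnion]
  · rfl

theorem defect_starTwoSolid (i j : Fin 4) :
    starTwoSolid.defect i j
      = if (i = 0 ∧ (j = 1 ∨ j = 2)) ∨ (j = 0 ∧ (i = 1 ∨ i = 2)) then 1
        else if (i = 0 ∧ j = 3) ∨ (j = 0 ∧ i = 3) then -1 else 0 := by
  fin_cases i <;> fin_cases j <;> simp [TwoColoredGraph.defect, starTwoSolid]

theorem sum_defect_disjUnion {W W' : Type*} [Fintype W] [Fintype W'] (H : TwoColoredGraph W)
    (H' : TwoColoredGraph W') :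
    ∑ x, ∑ y, (H.disjUnion H').defect x y
      = ∑ x, ∑ y, H.defect x y + ∑ x, ∑ y, H'.defect x y := by
  simp [defect_disjUnion, Fintype.sum_sum_type]

theorem sum_defect_matchingGraph (p q : ℕ) :
    ∑ x, ∑ y, (matchingGraph p q).defect x y = 2 * ((p : ℤ) - q) := by
  have h : ∀ x : (Fin p ⊕ Fin q) × Bool, ∑ y, (matchingGraph p q).defect x y
      = Sum.elim (fun _ => 1) (fun _ => -1) x.1 := by
    intro x
    rw [Finset.sum_eq_single (x.1, !x.2)]
    · simp [defect_matchingGraph]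
    · rintro ⟨s, c⟩ - hne
      rw [defect_matchingGraph, if_neg]
      rintro ⟨rfl, h⟩
      exact hne (Prod.ext rfl (by simpa using Bool.eq_not.2 (Ne.symm h)))
    · simp
  simp_rw [h]
  rw [Fintype.sum_prod_type]
  simp [Fintype.sum_sum_type]
  ring

theorem sum_defect_starTwoSolid : ∑ x, ∑ y, starTwoSolid.defect x y = 2 := by
  simp only [defect_starTwoSolid]
  decide

theorem defect_starOneSolid (i j : Fin 4) :
    starOneSolid.defect i j = - starTwoSolid.defect (Fin.rev i + 1) (Fin.rev j + 1) := by
  rw [defect_starTwoSolid]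
  fin_cases i <;> fin_cases j <;> simp [TwoColoredGraph.defect, starOneSolid]

/-- Complementation turns a star with two solid edges into a star with one solid edge. -/
theorem Realizes.swap_star {p q : ℕ} {lam : ℤ}
    (h : Realizes (starTwoSolid.disjUnion (matchingGraph p q)) lam) :
    Realizes (starOneSolid.disjUnion (matchingGraph q p)) (2 + 2 * p + 2 * q - lam) := by
  have h1 := h.swap
  have hcard : (Fintype.card (Fin 4 ⊕ (Fin p ⊕ Fin q) × Bool) : ℤ) - 2 - lam
      = 2 + 2 * p + 2 * q - lam := by
    simp; ring
  rw [hcard] at h1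
  let e : Fin 4 ≃ Fin 4 := Fin.revPerm.trans (Equiv.addRight 1)
  refine h1.transport (Equiv.sumCongr e ((Equiv.sumComm _ _).prodCongr (Equiv.refl _)))
    fun x y => ?_
  rw [TwoColoredGraph.defect_swap, defect_disjUnion, defect_disjUnion]
  rcases x with i | ⟨s | s, c⟩ <;> rcases y with j | ⟨s' | s', c'⟩ <;>
    simp [defect_matchingGraph, defect_starOneSolid, e, neg_ite]

theorem sum_defect_starOneSolid : ∑ x, ∑ y, starOneSolid.defect x y = -2 := by
  simp only [defect_starOneSolid, defect_starTwoSolid]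
  decide

theorem matchingGraph_disjoint {p q : ℕ} (x y : (Fin p ⊕ Fin q) × Bool)
    (h : (matchingGraph p q).solid.Adj x y) : ¬ (matchingGraph p q).dotted.Adj x y := by
  intro h'
  have h1 : x.1.isLeft = true := h.2.1
  have h2 : x.1.isRight = true := h'.2.1
  obtain ⟨s | s, c⟩ := x <;> simp at h1 h2

theorem disjUnion_disjoint {W W' : Type*} {H : TwoColoredGraph W} {H' : TwoColoredGraph W'}
    (h : ∀ x y, H.solid.Adj x y → ¬ H.dotted.Adj x y)
    (h' : ∀ x y, H'.solid.Adj x y → ¬ H'.dotted.Adj x y) (x y : W ⊕ W')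
    (hxy : (H.disjUnion H').solid.Adj x y) : ¬ (H.disjUnion H').dotted.Adj x y := by
  rcases x with x | x <;> rcases y with y | y
  · exact h x y hxy
  · simp [TwoColoredGraph.disjUnion]
  · simp [TwoColoredGraph.disjUnion]
  · exact h' x y hxy

theorem starTwoSolid_disjoint (i j : Fin 4) (h : starTwoSolid.solid.Adj i j) :
    ¬ starTwoSolid.dotted.Adj i j := by
  fin_cases i <;> fin_cases j <;> simp [starTwoSolid] at h ⊢

theorem starOneSolid_disjoint (i j : Fin 4) (h : starOneSolid.solid.Adj i j) :
    ¬ starOneSolid.dotted.Adj i j := by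
  fin_cases i <;> fin_cases j <;> simp [starOneSolid] at h ⊢

/-! ### From base systems to matchings and stars -/

/-- The two points of the hole `s.1` in the column `s.2`, indexed by `Bool`. -/
def holePoint {t : ℕ} (s : ZMod t × ZMod 3) (c : Bool) : ColumnPoint t :=
  ((s.1, bif c then 1 else 0), s.2)

theorem holePoint_injective {t : ℕ} {s s' : ZMod t × ZMod 3} {c c' : Bool}
    (h : holePoint s c = holePoint s' c') : s = s' ∧ c = c' := by
  simp only [holePoint, Prod.mk.injEq] at h
  refine ⟨Prod.ext h.1.1 h.2, ?_⟩
  have := h.1.2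
  cases c <;> cases c' <;> simp at this ⊢

/-- Labelling of the vertices of a matching by the points in the holes listed in `A` and `C`. -/
def matchingMap {t p q : ℕ} {A C : Finset (ZMod t × ZMod 3)} (eA : Fin p ≃ A) (eC : Fin q ≃ C)
    (x : (Fin p ⊕ Fin q) × Bool) : ColumnPoint t :=
  holePoint (Sum.elim (fun j => (eA j : ZMod t × ZMod 3)) (fun j => (eC j : ZMod t × ZMod 3)) x.1)
    x.2

section Matching

variable {t p q : ℕ} {A C : Finset (ZMod t × ZMod 3)} (eA : Fin p ≃ A) (eC : Fin q ≃ C)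

theorem matchingMap_injective (hAC : Disjoint A C) :
    Function.Injective (matchingMap eA eC) := by
  rintro ⟨s, c⟩ ⟨s', c'⟩ h
  obtain ⟨h1, rfl⟩ := holePoint_injective h
  have hne : ∀ j j', (eA j : ZMod t × ZMod 3) ≠ eC j' := fun j j' h =>
    Finset.disjoint_left.1 hAC (eA j).2 (h ▸ (eC j').2)
  rcases s with s | s <;> rcases s' with s' | s' <;> simp only [Sum.elim_inl, Sum.elim_inr] at h1
  · rw [eA.injective (Subtype.ext h1)]
  · exact absurd h1 (hne _ _)
  · exact absurd h1.symm (hne _ _)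
  · rw [eC.injective (Subtype.ext h1)]

theorem holeDefect_matchingMap {K : Finset (ZMod t)} (hA : ∀ s ∈ A, s.1 ∈ K)
    (hC : ∀ s ∈ C, s.1 ∉ K) {x y : (Fin p ⊕ Fin q) × Bool} (hxy : x ≠ y) :
    holeDefect K (matchingMap eA eC x) (matchingMap eA eC y)
      = (matchingGraph p q).defect x y := by
  have hAC : Disjoint A C := Finset.disjoint_left.2 fun s h h' => hC s h' (hA s h)
  have hinj := matchingMap_injective eA eC hAC
  rw [defect_matchingGraph]
  obtain ⟨s, c⟩ := x
  obtain ⟨s', c'⟩ := y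
  have h1 : ((matchingMap eA eC (s, c)).1.1 = (matchingMap eA eC (s', c')).1.1 ∧
      (matchingMap eA eC (s, c)).2 = (matchingMap eA eC (s', c')).2) ↔ s = s' := by
    constructor
    · intro h
      have h2 : matchingMap eA eC (s, c) = matchingMap eA eC (s', c) :=
        Prod.ext (Prod.ext h.1 rfl) h.2
      exact (Prod.ext_iff.1 (hinj h2)).1
    · rintro rfl
      exact ⟨rfl, rfl⟩
  rw [holeDefect]
  simp only [h1]
  by_cases hs : s = s'
  · subst hs
    have hc : c ≠ c' := fun h => hxy (by rw [h])
    rw [if_pos (show s = s from rfl), if_pos (show s = s ∧ c ≠ c' from ⟨rfl, hc⟩)]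
    rcases s with s | s
    · exact if_pos (hA _ (eA s).2)
    · exact if_neg (hC _ (eC s).2)
  · rw [if_neg hs, if_neg fun h => hs h.1]

end Matching

section Base

variable {t : ℕ} [NeZero t] {K : Finset (ZMod t)} {lam : ℤ}
  {T : ColumnPoint t → ColumnPoint t → ColumnPoint t → Prop}

theorem IsBase.realizes_matchingGraph (hT : IsBase K lam T) :
    Realizes (matchingGraph (3 * K.card) (3 * (t - K.card))) lam := by
  have hA : (K ×ˢ (Finset.univ : Finset (ZMod 3))).card = 3 * K.card := by
    rw [Finset.card_product, mul_comm]; simp [ZMod.card]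
  have hC : (Kᶜ ×ˢ (Finset.univ : Finset (ZMod 3))).card = 3 * (t - K.card) := by
    rw [Finset.card_product, mul_comm, Finset.card_compl]; simp [ZMod.card]
  have hK : K.card ≤ t := by simpa [ZMod.card] using Finset.card_le_univ K
  let eA := (Finset.equivFinOfCardEq hA).symm
  let eC := (Finset.equivFinOfCardEq hC).symm
  have hA' : ∀ s ∈ K ×ˢ (Finset.univ : Finset (ZMod 3)), s.1 ∈ K := by simp
  have hC' : ∀ s ∈ Kᶜ ×ˢ (Finset.univ : Finset (ZMod 3)), s.1 ∉ K := by simp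
  have hbij : Function.Bijective (matchingMap eA eC) := by
    rw [Fintype.bijective_iff_injective_and_card]
    refine ⟨matchingMap_injective _ _ (Finset.disjoint_left.2 fun s h h' => hC' s h' (hA' s h)), ?_⟩
    simp [ZMod.card]
    omega
  refine Realizes.of_equiv hT.1 (Equiv.ofBijective _ hbij) fun x y hxy => ?_
  rw [← holeDefect_matchingMap eA eC hA' hC' hxy]
  exact hT.2 _ _ (hbij.1.ne hxy)

/-- Addition of one new block `B` raises the degrees of the three pairs in `B` by one. -/
theorem pairDegree_or_mem {V : Type*} [Finite V] [DecidableEq V] {T : V → V → V → Prop}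
    (B : Finset V) (hB : B.card = 3)
    (hnew : ∀ p ∈ B, ∀ q ∈ B, ∀ z ∈ B, p ≠ q → z ≠ p → z ≠ q → ¬ T p q z) {p q : V}
    (hpq : p ≠ q) :
    pairDegree (fun p q z => T p q z ∨ (p ∈ B ∧ q ∈ B ∧ z ∈ B)) p q
      = pairDegree T p q + if p ∈ B ∧ q ∈ B then 1 else 0 := by
  have h1 : {z | z ≠ p ∧ z ≠ q ∧ (T p q z ∨ (p ∈ B ∧ q ∈ B ∧ z ∈ B))}
      = {z | z ≠ p ∧ z ≠ q ∧ T p q z} ∪ {z | z ≠ p ∧ z ≠ q ∧ p ∈ B ∧ q ∈ B ∧ z ∈ B} := by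
    ext z
    simp only [Set.mem_ofPred_eq, Set.mem_union]
    tauto
  rw [pairDegree, h1, Set.ncard_union_eq _ (Set.toFinite _) (Set.toFinite _), pairDegree]
  · congr 1
    split_ifs with h
    · have h2 : {z | z ≠ p ∧ z ≠ q ∧ p ∈ B ∧ q ∈ B ∧ z ∈ B} = ((B.erase p).erase q : Finset V) := by
        ext z
        simp [h]
        tauto
      rw [h2, Set.ncard_coe_finset, Finset.card_erase_of_mem (by simp [h, hpq.symm]),
        Finset.card_erase_of_mem h.1, hB]
    · refine (congrArg Set.ncard (?_ : _ = ∅)).trans (Set.ncard_empty _)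
      ext z
      simp only [Set.mem_ofPred_eq, Set.mem_empty_iff_false, iff_false]
      tauto
  · rw [Set.disjoint_left]
    rintro z ⟨-, -, h⟩ ⟨h2, h3, h4, h5, h6⟩
    exact hnew p h4 q h5 z h6 hpq h2 h3 h

/-- The star has its centre `(a, 0)` in the second column; its leaves are the two points of the hole
`a` in the first column and the point `(a, 1)` of the second column. -/
theorem IsBase.realizes_star (hT : IsBase K lam T) {a : ZMod t} (ha : a ∉ K)
    (hstar : ¬ IsStarBlock T a) :
    Realizes (starTwoSolid.disjUnion (matchingGraph (3 * K.card) (3 * (t - K.card) - 2))) lam := by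
  have hA : (K ×ˢ (Finset.univ : Finset (ZMod 3))).card = 3 * K.card := by
    rw [Finset.card_product, mul_comm]; simp [ZMod.card]
  have hC : (((Kᶜ ×ˢ (Finset.univ : Finset (ZMod 3))).erase (a, 0)).erase (a, 1)).card
      = 3 * (t - K.card) - 2 := by
    rw [Finset.card_erase_of_mem (by simp [ha]), Finset.card_erase_of_mem (by simp [ha]),
      Finset.card_product, mul_comm, Finset.card_compl]
    simp [ZMod.card]
    omega
  have hK : K.card < t := by
    have := Finset.card_lt_univ_of_notMem ha
    simpa [ZMod.card] using this
  let eA := (Finset.equivFinOfCardEq hA).symm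
  let eC := (Finset.equivFinOfCardEq hC).symm
  have hA' : ∀ s ∈ K ×ˢ (Finset.univ : Finset (ZMod 3)), s.1 ∈ K := by simp
  have hC' : ∀ s ∈ ((Kᶜ ×ˢ (Finset.univ : Finset (ZMod 3))).erase (a, 0)).erase (a, 1),
      s.1 ∉ K := by
    simp
  have hAC := Finset.disjoint_left.2 fun s h h' => hC' s h' (hA' s h)
  let star : Fin 4 → ColumnPoint t :=
    ![((a, 0), 1), ((a, 0), 0), ((a, 1), 0), ((a, 1), 1)]
  let f : Fin 4 ⊕ ((Fin (3 * K.card) ⊕ Fin (3 * (t - K.card) - 2)) × Bool) → ColumnPoint t :=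
    Sum.elim star (matchingMap eA eC)
  let B : Finset (ColumnPoint t) := {((a, 0), 0), ((a, 1), 0), ((a, 0), 1)}
  have hstar1 : ∀ i, (star i).1.1 = a ∧ ((star i).2 = 0 ∨ (star i).2 = 1) := by
    intro i
    fin_cases i <;> simp [star]
  have hmatch : ∀ x, ¬ ((matchingMap eA eC x).1.1 = a ∧
      ((matchingMap eA eC x).2 = 0 ∨ (matchingMap eA eC x).2 = 1)) := by
    rintro ⟨s | s, c⟩ ⟨h1, h2⟩
    · exact ha (h1 ▸ hA' _ (eA s).2)
    · have h3 := (eC s).2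
      simp only [Finset.mem_erase] at h3
      rcases h2 with h2 | h2
      · exact h3.2.1 (Prod.ext h1 h2)
      · exact h3.1 (Prod.ext h1 h2)
  have hstarinj : Function.Injective star := by
    intro i j h
    fin_cases i <;> fin_cases j <;> simp [star] at h ⊢
  have hinj : Function.Injective f := by
    rintro (i | x) (j | y) h
    · rw [hstarinj h]
    · exact absurd (show star i = matchingMap eA eC y from h) fun h => hmatch y (h ▸ hstar1 i)
    · exact absurd (show star j = matchingMap eA eC x from h.symm) fun h => hmatch x (h ▸ hstar1 j)
    · rw [matchingMap_injective eA eC hAC h]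
  have hbij : Function.Bijective f := by
    rw [Fintype.bijective_iff_injective_and_card]
    refine ⟨hinj, ?_⟩
    simp [ZMod.card]
    omega
  have hBstar : ∀ z ∈ B, z.1.1 = a ∧ (z.2 = 0 ∨ z.2 = 1) := by
    intro z hz
    simp only [B, Finset.mem_insert, Finset.mem_singleton] at hz
    rcases hz with rfl | rfl | rfl <;> simp
  have hB : B.card = 3 := by
    rw [Finset.card_eq_three]
    exact ⟨_, _, _, by simp, by simp, by simp, rfl⟩
  have hnew : ∀ p ∈ B, ∀ q ∈ B, ∀ z ∈ B, p ≠ q → z ≠ p → z ≠ q → ¬ T p q z := by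
    have h1 := hT.1
    intro p hp q hq z hz hpq hzp hzq h
    have h2 := h1.swap_left h
    have h3 := h1.swap_right h
    have h4 := h1.swap_right h2
    have h5 := h1.swap_left h3
    have h6 := h1.swap_left h4
    simp only [B, Finset.mem_insert, Finset.mem_singleton] at hp hq hz
    rcases hp with rfl | rfl | rfl <;> rcases hq with rfl | rfl | rfl <;>
      rcases hz with rfl | rfl | rfl <;> contradiction
  have hsymm : IsSymmetricTernary (fun p q z => T p q z ∨ (p ∈ B ∧ q ∈ B ∧ z ∈ B)) :=
    ⟨fun h => h.imp (fun h => hT.1.swap_left h) fun h => ⟨h.2.1, h.1, h.2.2⟩,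
      fun h => h.imp (fun h => hT.1.swap_right h) fun h => ⟨h.1, h.2.2, h.2.1⟩⟩
  refine Realizes.of_equiv hsymm (Equiv.ofBijective f hbij) fun x y hxy => ?_
  have hne := hbij.1.ne hxy
  rw [Equiv.ofBijective_apply, Equiv.ofBijective_apply, pairDegree_or_mem B hB hnew hne,
    Nat.cast_add, hT.2 _ _ hne, defect_disjUnion, add_assoc]
  congr 1
  have hmB : ∀ x, matchingMap eA eC x ∉ B := fun x h => hmatch x (hBstar _ h)
  rcases x with i | x <;> rcases y with j | y
  · simp only [Sum.elim_inl, f, defect_starTwoSolid]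
    fin_cases i <;> fin_cases j <;> first | exact absurd rfl hxy | simp [star, B, holeDefect, ha]
  · simp only [Sum.elim_inl, Sum.elim_inr, f, hmB, and_false, if_false, holeDefect]
    have hno : ¬ ((star i).1.1 = (matchingMap eA eC y).1.1 ∧
        (star i).2 = (matchingMap eA eC y).2) := fun h =>
      hmatch y ⟨h.1 ▸ (hstar1 i).1, h.2 ▸ (hstar1 i).2⟩
    simp [hno]
  · simp only [Sum.elim_inl, Sum.elim_inr, f, hmB, false_and, if_false, holeDefect]
    have hno : ¬ ((matchingMap eA eC x).1.1 = (star j).1.1 ∧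
        (matchingMap eA eC x).2 = (star j).2) := fun h =>
      hmatch x ⟨h.1.symm ▸ (hstar1 j).1, h.2.symm ▸ (hstar1 j).2⟩
    simp [hno]
  · simp only [Sum.elim_inr, f, hmB, false_and, if_false]
    rw [holeDefect_matchingMap eA eC hA' hC' fun h => hxy (by rw [h])]
    simp

theorem IsBase.compl (hT : IsBase K lam T) :
    IsBase Kᶜ (6 * t - 2 - lam) fun p q z => ¬ T p q z := by
  refine ⟨⟨fun h h' => h (hT.1.swap_left h'), fun h h' => h (hT.1.swap_right h')⟩,
    fun p q hpq => ?_⟩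
  have h1 := pairDegree_add_pairDegree_not T hpq
  have h2 := hT.2 p q hpq
  have h3 : Fintype.card (ColumnPoint t) = 6 * t := by simp [ZMod.card]; ring
  have h4 : holeDefect Kᶜ p q = - holeDefect K p q := by
    simp only [holeDefect, Finset.mem_compl]
    split_ifs <;> rfl
  omega

end Base


/-! ### Base systems on twelve points -/

/-- A triple system on three columns of four points, invariant under the cyclic shift of the columns
and without triples inside a column. The points of a column are numbered from `0` to `3`. An entry
`(x, y, w)` of `next` or `prev` stands for the blocks with `x` and `y` in one column and `w` in the
next or in the previous column, an entry `(x, y, w)` of `trans` for the blocks with `x`, `y` and `w`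
in three consecutive columns. -/
structure CyclicSystem where
  /-- blocks with a pair in a column and a point in the next column -/
  next : List (ℕ × ℕ × ℕ)
  /-- blocks with a pair in a column and a point in the previous column -/
  prev : List (ℕ × ℕ × ℕ)
  /-- transversal blocks -/
  trans : List (ℕ × ℕ × ℕ)

/-- The number of a point of a column. -/
def pointNumber (x : ZMod 2 × ZMod 2) : ℕ := 2 * x.1.val + x.2.val

/-- Membership in a list of triples of numbers that are unordered in the first two entries. -/
def PairMem (L : List (ℕ × ℕ × ℕ)) (x y w : ZMod 2 × ZMod 2) : Prop :=
  (pointNumber x, pointNumber y, pointNumber w) ∈ L ∨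
    (pointNumber y, pointNumber x, pointNumber w) ∈ L

/-- Membership in a list of triples of numbers up to cyclic shifts. -/
def CyclicMem (L : List (ℕ × ℕ × ℕ)) (x y w : ZMod 2 × ZMod 2) : Prop :=
  (pointNumber x, pointNumber y, pointNumber w) ∈ L ∨
    (pointNumber y, pointNumber w, pointNumber x) ∈ L ∨
      (pointNumber w, pointNumber x, pointNumber y) ∈ L

instance (L : List (ℕ × ℕ × ℕ)) (x y w : ZMod 2 × ZMod 2) : Decidable (PairMem L x y w) :=
  inferInstanceAs (Decidable (_ ∨ _))

instance (L : List (ℕ × ℕ × ℕ)) (x y w : ZMod 2 × ZMod 2) : Decidable (CyclicMem L x y w) :=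
  inferInstanceAs (Decidable (_ ∨ _))

theorem CyclicMem.rotate {L : List (ℕ × ℕ × ℕ)} {x y w : ZMod 2 × ZMod 2} (h : CyclicMem L x y w) :
    CyclicMem L y w x := by
  rcases h with h | h | h
  · exact .inr (.inr h)
  · exact .inl h
  · exact .inr (.inl h)

namespace CyclicSystem

/-- The ternary relation on points that corresponds to the system. -/
def rel (D : CyclicSystem) : ColumnPoint 2 → ColumnPoint 2 → ColumnPoint 2 → Prop :=
  ColumnRel (fun _ => PairMem D.next) (fun _ => PairMem D.prev)
    (fun u => CyclicMem D.trans (u 0) (u 1) (u 2))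

/-- The pair degrees required of a base system with `K = {0}`, expressed in one column and between
two consecutive columns. -/
def Valid (D : CyclicSystem) (lam : ℕ) : Prop :=
  (∀ x y : ZMod 2 × ZMod 2, x ≠ y →
    ((Finset.univ.filter fun w => PairMem D.next x y w).card
      + (Finset.univ.filter fun w => PairMem D.prev x y w).card : ℤ)
      = lam + holeDefect {0} (x, 0) (y, 0)) ∧
  (∀ x y : ZMod 2 × ZMod 2,
    (Finset.univ.filter fun w => w ≠ x ∧ PairMem D.next w x y).card
      + (Finset.univ.filter fun w => w ≠ y ∧ PairMem D.prev y w x).card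
      + (Finset.univ.filter fun w => CyclicMem D.trans x y w).card = lam) ∧
  PairMem D.next (0, 0) (0, 1) (0, 0) ∧ ¬ PairMem D.next (1, 0) (1, 1) (1, 0)

instance (D : CyclicSystem) (lam : ℕ) : Decidable (D.Valid lam) :=
  inferInstanceAs (Decidable (_ ∧ _ ∧ _ ∧ _))

theorem isBase {D : CyclicSystem} {lam : ℕ} (h : D.Valid lam) : IsBase {0} lam D.rel := by
  obtain ⟨h1, h2, -⟩ := h
  have hT : IsSymmetricTernary D.rel :=
    isSymmetricTernary_columnRel (fun _ _ _ _ h => h.symm) fun _ _ _ _ h => h.symm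
  have hncard : ∀ (p : ZMod 2 × ZMod 2 → Prop) [DecidablePred p],
      {w | p w}.ncard = (Finset.univ.filter p).card := by
    intro p _
    rw [← Set.ncard_coe_finset]
    congr 1
    ext w
    simp
  have hne : ∀ i : ZMod 3, i ≠ i + 1 := by decide
  have htrans : ∀ x y i, {w | ∃ u : ZMod 3 → ZMod 2 × ZMod 2,
      CyclicMem D.trans (u 0) (u 1) (u 2) ∧ u i = x ∧ u (i + 1) = y ∧ u (i + 2) = w}
        = {w | CyclicMem D.trans x y w} := by
    intro x y i
    have hi : i = 0 ∨ i = 1 ∨ i = 2 := by revert i; decide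
    ext w
    rcases hi with rfl | rfl | rfl
    · constructor
      · rintro ⟨u, h, rfl, rfl, rfl⟩; exact h
      · intro h; exact ⟨![x, y, w], h, rfl, rfl, rfl⟩
    · constructor
      · rintro ⟨u, h, rfl, rfl, rfl⟩; exact h.rotate
      · intro h; exact ⟨![w, x, y], h.rotate.rotate, rfl, rfl, rfl⟩
    · constructor
      · rintro ⟨u, h, rfl, rfl, rfl⟩; exact h.rotate.rotate
      · intro h; exact ⟨![y, w, x], h.rotate, rfl, rfl, rfl⟩
  have hsucc : ∀ x y i, pairDegree D.rel (x, i) (y, i + 1) = lam := by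
    intro x y i
    rw [rel, pairDegree_columnRel_succ, htrans, hncard, hncard, hncard, h2]
  refine ⟨hT, ?_⟩
  rintro ⟨x, i⟩ ⟨y, j⟩ hpq
  have hall : ∀ i j : ZMod 3, j = i ∨ j = i + 1 ∨ i = j + 1 := by decide
  rcases hall i j with rfl | rfl | rfl
  · have h3 := h1 x y fun h => hpq (by rw [h])
    rw [rel, pairDegree_columnRel_same, hncard, hncard, Nat.cast_add, h3]
    simp [holeDefect]
  · rw [hsucc]; simp [holeDefect, hne]
  · rw [pairDegree_comm hT, hsucc]; simp [holeDefect, (hne _).symm]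

theorem isStarBlock_iff (D : CyclicSystem) (a : ZMod 2) :
    IsStarBlock D.rel a ↔ PairMem D.next (a, 0) (a, 1) (a, 0) := by
  have h1 : (0 : ZMod 3) ≠ 1 := by decide
  have h2 : (1 : ZMod 3) ≠ 0 := by decide
  have h3 : (1 : ZMod 3) ≠ 2 := by decide
  simp [IsStarBlock, rel, ColumnRel, ApexRel, TransversalRel, h1, h2, h3]

end CyclicSystem

/-- A base system on twelve points with `lam = 1`. -/
def cyclicSystemOne : CyclicSystem where
  next := [(0, 1, 0), (0, 1, 3), (0, 2, 2)]
  prev := [(0, 3, 3), (1, 2, 3), (1, 3, 2)]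
  trans := [(0, 1, 2), (1, 1, 1)]

/-- A base system on twelve points with `lam = 3`. -/
def cyclicSystemThree : CyclicSystem where
  next := [(0, 1, 0), (0, 1, 3), (0, 2, 0), (0, 2, 2), (0, 3, 1), (0, 3, 2), (1, 2, 1), (1, 2, 3),
    (1, 3, 0), (1, 3, 2)]
  prev := [(0, 1, 0), (0, 1, 2), (0, 2, 1), (0, 3, 3), (1, 2, 3), (1, 3, 2), (2, 3, 0), (2, 3, 2)]
  trans := [(0, 1, 2), (0, 3, 3), (1, 1, 1), (1, 1, 3), (2, 2, 2), (3, 3, 3)]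

/-- A base system on twelve points with `lam = 5`. -/
def cyclicSystemFive : CyclicSystem where
  next := [(0, 1, 0), (0, 1, 1), (0, 1, 3), (0, 2, 0), (0, 2, 3), (0, 3, 1), (0, 3, 2), (0, 3, 3),
    (1, 2, 1), (1, 3, 0), (1, 3, 2), (1, 3, 3), (2, 3, 3)]
  prev := [(0, 1, 0), (0, 1, 1), (0, 1, 3), (0, 2, 1), (0, 2, 2), (0, 2, 3), (0, 3, 2), (0, 3, 3),
    (1, 2, 0), (1, 2, 1), (1, 2, 2), (1, 2, 3), (1, 3, 2), (1, 3, 3), (2, 3, 0), (2, 3, 1),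
    (2, 3, 2)]
  trans := [(0, 0, 0), (0, 0, 2), (0, 1, 3), (0, 2, 2), (0, 3, 1), (1, 1, 1), (1, 2, 2), (1, 3, 2)]

theorem exists_valid_cyclicSystem {lam : ℕ} (hlam : Odd lam) (h5 : lam ≤ 5) :
    ∃ D : CyclicSystem, D.Valid lam := by
  have h : lam = 1 ∨ lam = 3 ∨ lam = 5 := by
    obtain ⟨r, rfl⟩ := hlam; omega
  rcases h with rfl | rfl | rfl
  · exact ⟨cyclicSystemOne, by decide +kernel⟩
  · exact ⟨cyclicSystemThree, by decide +kernel⟩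
  · exact ⟨cyclicSystemFive, by decide +kernel⟩


/-! ### Existence of base systems for all indices -/

/-- All odd indices up to one more than half of `6 t - 2` occur: the base system with index one is
supplemented by twofold designs, whose number is bounded by the number of shift vectors. -/
theorem exists_isBase_of_le {t : ℕ} [NeZero t] (ht : t ≠ 2) (K : Finset (ZMod t)) {lam : ℕ}
    (hodd : Odd lam) (hlam : lam ≤ 3 * t - 1) :
    ∃ T, IsBase K lam T ∧ ∀ a ∉ K, ¬ IsStarBlock T a := by
  have ht0 : 0 < t := Nat.pos_of_neZero t
  obtain ⟨op, hop⟩ : ∃ op : ZMod t × ZMod 2 → ZMod t × ZMod 2 → ZMod t × ZMod 2, IsHoley op := by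
    rcases Nat.even_or_odd t with h | h
    · exact exists_isHoley_of_even h (by obtain ⟨r, rfl⟩ := h; omega)
    · exact exists_isHoley_of_odd h
  obtain ⟨S₀, hS₀, h0, hcard, hcard'⟩ := exists_isShiftSet t ht0
  obtain ⟨m, rfl⟩ := hodd
  -- The zero shift is reserved for the base system, in one of the two orientations.
  have hm : m ≤ S₀.card + (S₀.card - 1) := by
    rcases Nat.even_or_odd t with h | h
    · obtain ⟨r, rfl⟩ := h; omega
    · have := hcard' h; omega
  obtain ⟨S', hS', hc'⟩ := Finset.exists_subset_card_eq (min_le_right m S₀.card)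
  obtain ⟨S, hS, hc⟩ := Finset.exists_subset_card_eq
    (s := S₀.erase 0) (n := m - min m S₀.card) (by rw [Finset.card_erase_of_mem h0]; omega)
  obtain ⟨T, hT, hstar⟩ := exists_isBase_of_isShiftSet hop K
    (hS₀.mono (hS.trans (Finset.erase_subset _ _))) (fun r hr i hri => by
      obtain ⟨hr0, hr⟩ := Finset.mem_erase.1 (hS hr)
      exact hr0 (hS₀.injOn i hr h0 hri)) (hS₀.mono hS')
  refine ⟨T, ?_, hstar⟩
  convert hT using 1
  push_cast
  omega

/-- There is a base system whose set `K` has `k` elements and to which a star block outside `K` can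
be added. -/
def HasStarBase (t k : ℕ) [NeZero t] (lam : ℤ) : Prop :=
  ∃ K : Finset (ZMod t), K.card = k ∧ ∃ T, IsBase K lam T ∧ ∃ a ∉ K, ¬ IsStarBlock T a

theorem exists_finset_card {t k : ℕ} [NeZero t] (hk : k ≤ t) :
    ∃ K : Finset (ZMod t), K.card = k := by
  obtain ⟨K, -, hK⟩ := Finset.exists_subset_card_eq (s := (Finset.univ : Finset (ZMod t))) (n := k)
    (by simpa [ZMod.card] using hk)
  exact ⟨K, hK⟩

theorem hasStarBase_of_le {t k : ℕ} [NeZero t] (ht : t ≠ 2) (hk : k < t) {lam : ℕ}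
    (hodd : Odd lam) (hlam : lam ≤ 3 * t - 1) : HasStarBase t k lam := by
  obtain ⟨K, hK⟩ := exists_finset_card hk.le
  obtain ⟨T, hT, hstar⟩ := exists_isBase_of_le ht K hodd hlam
  have hne : K ≠ Finset.univ := by
    rintro rfl
    rw [Finset.card_univ, ZMod.card] at hK
    omega
  obtain ⟨a, ha⟩ : ∃ a, a ∉ K := by
    by_contra! h
    exact hne (Finset.eq_univ_iff_forall.2 h)
  exact ⟨K, hK, T, hT, a, ha, hstar a ha⟩

/-- For twelve points, the block on the hole in `K` belongs to the explicit systems, so that it can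
be added to their complements. -/
theorem hasStarBase_two {lam : ℕ} (hodd : Odd lam) (hlam : lam ≤ 9) : HasStarBase 2 1 lam := by
  rcases le_or_gt lam 5 with h | h
  · obtain ⟨D, hD⟩ := exists_valid_cyclicSystem hodd h
    exact ⟨{0}, rfl, D.rel, CyclicSystem.isBase hD, 1, by decide,
      fun hs => hD.2.2.2 ((D.isStarBlock_iff 1).1 hs)⟩
  · obtain ⟨r, hr⟩ := hodd
    obtain ⟨D, hD⟩ := exists_valid_cyclicSystem (lam := 10 - lam) ⟨4 - r, by omega⟩ (by omega)
    refine ⟨{0}ᶜ, by decide, fun p q z => ¬ D.rel p q z, ?_, 0, by decide,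
      fun hs => hs ((D.isStarBlock_iff 0).2 hD.2.2.1)⟩
    have := (CyclicSystem.isBase hD).compl
    convert this using 1
    omega

/-- Indices above `3 t - 1` are reached by complementation, which exchanges `K` with its
complement. -/
theorem exists_isBase {t k : ℕ} [NeZero t] (hk : 0 < k) (hkt : k < t) {lam : ℕ} (hodd : Odd lam)
    (hlam : lam + 3 ≤ 6 * t) : ∃ K : Finset (ZMod t), K.card = k ∧ ∃ T, IsBase K lam T := by
  by_cases ht : t = 2
  · subst ht
    obtain rfl : k = 1 := by omega
    obtain ⟨K, hK, T, hT, -⟩ := hasStarBase_two hodd (by omega)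
    exact ⟨K, hK, T, hT⟩
  · rcases le_or_gt lam (3 * t - 1) with h | h
    · obtain ⟨K, hK⟩ := exists_finset_card hkt.le
      obtain ⟨T, hT, -⟩ := exists_isBase_of_le ht K hodd h
      exact ⟨K, hK, T, hT⟩
    · obtain ⟨K, hK⟩ := exists_finset_card (Nat.sub_le t k)
      obtain ⟨r, hr⟩ := hodd
      obtain ⟨T, hT, -⟩ := exists_isBase_of_le ht K (lam := 6 * t - 2 - lam)
        ⟨3 * t - 2 - r, by omega⟩ (by omega)
      refine ⟨Kᶜ, ?_, fun p q z => ¬ T p q z, ?_⟩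
      · rw [Finset.card_compl, ZMod.card, hK]; omega
      · have := hT.compl
        convert this using 1
        omega

/-- Complementation need not preserve the possibility of adding a star block, so that one of the two
complementary parameter sets is treated and the complement is taken after the block is added. -/
theorem hasStarBase_or {t k : ℕ} [NeZero t] (hkt : k < t) {lam : ℕ} (hodd : Odd lam)
    (hlam : lam + 3 ≤ 6 * t) :
    HasStarBase t k lam ∨ HasStarBase t (t - 1 - k) (6 * t - 2 - lam) := by
  obtain ⟨r, hr⟩ := hodd
  have hsub : (6 * t - 2 - lam : ℤ) = ((6 * t - 2 - lam : ℕ) : ℤ) := by omega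
  have hodd' : Odd (6 * t - 2 - lam) := ⟨3 * t - 2 - r, by omega⟩
  rw [hsub]
  by_cases ht : t = 2
  · subst ht
    have h : k = 0 ∨ k = 1 := by omega
    rcases h with rfl | rfl
    · exact .inr (hasStarBase_two hodd' (by omega))
    · exact .inl (hasStarBase_two ⟨r, hr⟩ (by omega))
  · rcases le_or_gt lam (3 * t - 1) with h | h
    · exact .inl (hasStarBase_of_le ht hkt ⟨r, hr⟩ h)
    · exact .inr (hasStarBase_of_le ht (by omega) hodd' (by omega))

theorem HasStarBase.realizes {t k : ℕ} [NeZero t] {lam : ℤ} (h : HasStarBase t k lam) :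
    Realizes (starTwoSolid.disjUnion (matchingGraph (3 * k) (3 * (t - k) - 2))) lam := by
  obtain ⟨K, rfl, T, hT, a, ha, hs⟩ := h
  exact hT.realizes_star ha hs

/-! ### The parameters -/

theorem choose_two_six_mul (t : ℕ) : ((6 * t).choose 2 : ℤ) = 3 * t * (6 * t - 1) := by
  rcases t with _ | t
  · simp
  · rw [Nat.choose_two_right, show 6 * (t + 1) * (6 * (t + 1) - 1)
      = 2 * (3 * (t + 1) * (6 * t + 5)) by
        rw [show 6 * (t + 1) - 1 = 6 * t + 5 by omega]; ring, Nat.mul_div_cancel_left _ two_pos]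
    push_cast; ring

/-- Condition (C2) for `v = 6 t`: the number of blocks differs by less than `t` from
`lam * v * (v - 1) / 6`. -/
theorem SatisfiesC2.exists_deviation {t b : ℕ} (hb : SatisfiesC2 (6 * t) b) :
    ∃ lam d : ℤ, Odd lam ∧ 0 < lam ∧ (b : ℤ) = lam * (t * (6 * t - 1)) + d ∧
      -(t : ℤ) < d ∧ d < t := by
  obtain ⟨-, lam, hodd, h1, h2⟩ := hb
  refine ⟨lam, b - lam * (t * (6 * t - 1)), hodd, ?_, by ring, ?_, ?_⟩
  · by_contra! hneg
    have h3 : lam ≤ -1 := by obtain ⟨r, rfl⟩ := hodd; omega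
    have h4 : (lam : ℚ) ≤ -1 := by exact_mod_cast h3
    have h5 : (0 : ℚ) ≤ b := by positivity
    have h6 : (t : ℚ) = 0 ∨ (1 : ℚ) ≤ t := by
      rcases Nat.eq_zero_or_pos t with h | h
      · left; exact_mod_cast h
      · right; exact_mod_cast h
    push_cast at h1 h2
    rcases h6 with h6 | h6
    · rw [h6] at h1 h2; linarith
    · nlinarith [mul_nonneg (by linarith : (0 : ℚ) ≤ t) (by linarith : (0 : ℚ) ≤ t - 1),
        mul_nonneg (mul_nonneg (by linarith : (0 : ℚ) ≤ t) (by linarith : (0 : ℚ) ≤ 6 * t - 1))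
          (by linarith : (0 : ℚ) ≤ -1 - lam)]
  · have : -(t : ℚ) < b - lam * (t * (6 * t - 1)) := by push_cast at h1; linarith
    exact_mod_cast this
  · have : (b : ℚ) - lam * (t * (6 * t - 1)) < t := by push_cast at h2; linarith
    exact_mod_cast this

end TripleSystems

theorem theoremv06 (v b : ℕ) (hv : v ≡ 0 [MOD 6]) (hb : TripleSystems.SatisfiesC2 v b) :
    ∃ F : Multiset (Finset (Fin v)), TripleSystems.IsNWBTS F v b := by
  open TripleSystems in
  obtain ⟨t, rfl⟩ : 6 ∣ v := (Nat.modEq_zero_iff_dvd).1 hv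
  obtain ⟨lam, d, hodd, hpos, hbd, hd1, hd2⟩ := hb.exists_deviation
  have ht : 0 < t := by omega
  have : NeZero t := ⟨ht.ne'⟩
  have hchoose := choose_two_six_mul t
  have hb3 : 3 * (b : ℤ) = lam * ((6 * t).choose 2 : ℤ) + 3 * d := by
    rw [hchoose, hbd]; ring
  -- Copies of the set of all triples account for a multiple of `6 t - 2` in the index.
  obtain ⟨m, mu, hmu, hmuodd, hmule⟩ : ∃ m mu : ℕ, lam = m * (((6 * t : ℕ) : ℤ) - 2) + mu ∧
      Odd mu ∧ mu + 3 ≤ 6 * t := by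
    lift lam to ℕ using hpos.le
    have h1 := Nat.div_add_mod' lam (6 * t - 2)
    have h2 := Nat.mod_lt lam (show 0 < 6 * t - 2 by omega)
    have h3 : lam % (6 * t - 2) % 2 = lam % 2 :=
      Nat.mod_mod_of_dvd _ (show 2 ∣ 6 * t - 2 by omega)
    have h4 : lam % 2 = 1 := Nat.odd_iff.1 (by exact_mod_cast hodd)
    refine ⟨lam / (6 * t - 2), lam % (6 * t - 2), ?_, Nat.odd_iff.2 (by omega), by omega⟩
    rw [show (((6 * t : ℕ) : ℤ) - 2) = ((6 * t - 2 : ℕ) : ℤ) by omega]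
    exact_mod_cast h1.symm
  have hassoc : IsAssociated (6 * t) b lam (3 * d) := by
    refine ⟨hb3, ?_, ?_⟩
    · have : -(t : ℚ) < d := by exact_mod_cast hd1
      push_cast; linarith
    · have : (d : ℚ) < t := by exact_mod_cast hd2
      push_cast; linarith
  have hhalf : 6 * t / 2 = 3 * t := by omega
  by_cases hpar : 3 * d ≡ ((6 * t / 2 : ℕ) : ℤ) [ZMOD 2]
  · have hpar' := hpar
    rw [hhalf, Int.ModEq] at hpar'
    obtain ⟨k, hk⟩ : ∃ k : ℕ, d = 2 * k - t := ⟨((d + t) / 2).toNat, by omega⟩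
    obtain ⟨K, hK, T, hT⟩ := exists_isBase (t := t) (k := k) (by omega) (by omega) hmuodd hmule
    have hreal := hT.realizes_matchingGraph
    rw [hK] at hreal
    obtain ⟨F, hF1, hF2, hF3⟩ := exists_isBalanced_of_realizes (v := 6 * t) (b := b)
      (eps := 3 * d) (by simp; omega) hreal hmu matchingGraph_disjoint
      (by rw [sum_defect_matchingGraph]; omega) hb3
    exact ⟨F, Fintype.card_fin _, hF1, ⟨hb, lam, 3 * d, hodd, hassoc,
      fun _ => ⟨3 * k, 3 * (t - k), by omega, by omega, hF3⟩, fun h => absurd hpar h⟩, hF2⟩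
  · have hpar' := hpar
    rw [hhalf, Int.ModEq] at hpar'
    have hodd' : (d + t) % 2 = 1 := by
      rcases Int.emod_two_eq_zero_or_one (d + t) with h | h
      · exact absurd (by omega) hpar'
      · exact h
    obtain ⟨k, hk⟩ : ∃ k : ℕ, d = 2 * k + 1 - t := ⟨((d + t - 1) / 2).toNat, by omega⟩
    rcases hasStarBase_or (t := t) (k := k) (by omega) hmuodd hmule with h | h
    · obtain ⟨F, hF1, hF2, hF3⟩ := exists_isBalanced_of_realizes (v := 6 * t) (b := b)
        (eps := 3 * d) (by simp; omega) h.realizes hmu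
        (disjUnion_disjoint starTwoSolid_disjoint matchingGraph_disjoint)
        (by rw [sum_defect_disjUnion, sum_defect_starTwoSolid, sum_defect_matchingGraph]; omega) hb3
      exact ⟨F, Fintype.card_fin _, hF1, ⟨hb, lam, 3 * d, hodd, hassoc, fun h => absurd h hpar,
        fun _ => .inl ⟨3 * k, 3 * (t - k) - 2, by omega, by omega, hF3⟩⟩, hF2⟩
    · have hreal := h.realizes.swap_star
      rw [show (2 + 2 * ((3 * (t - 1 - k) : ℕ) : ℤ) + 2 * ((3 * (t - (t - 1 - k)) - 2 : ℕ) : ℤ)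
        - (6 * t - 2 - mu)) = mu by omega] at hreal
      obtain ⟨F, hF1, hF2, hF3⟩ := exists_isBalanced_of_realizes (v := 6 * t) (b := b)
        (eps := 3 * d) (by simp; omega) hreal hmu
        (disjUnion_disjoint starOneSolid_disjoint matchingGraph_disjoint)
        (by rw [sum_defect_disjUnion, sum_defect_starOneSolid, sum_defect_matchingGraph]; omega) hb3
      exact ⟨F, Fintype.card_fin _, hF1, ⟨hb, lam, 3 * d, hodd, hassoc, fun h => absurd h hpar,
        fun _ => .inr ⟨3 * (t - (t - 1 - k)) - 2, 3 * (t - 1 - k), by omega, by omega, hF3⟩⟩, hF2⟩
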